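/- Let $\mathcal H$ be a separable complex Hilbert space with unit sphere $\mathbb S(\mathcal H)$, let $B$ be a bounded operator on $\mathcal H$, let $\rho$ be a density matrix on $\mathcal H$ (a positive trace-class operator with $\operatorname{tr}\rho=1$), and let $(U_t)_{t\ge 0}$ be a measurable family of unitary operators on $\mathcal H$ (that is, $t\mapsto U_t\varphi$ is measurable for every $\varphi\in\mathcal H$). Let $\mathrm{GAP}(\rho)$ be the following probability measure on $\mathbb S(\mathcal H)$: write $\rho=\sum_n p_n|n\rangle\langle n|$ with an orthonormal eigenbasis $(|n\rangle)_n$; let $\mathrm G(\rho)$ be the law of $\sum_n Z_n|n\rangle$, where the $Z_n$ are independent complex Gaussian random variables with mean $0$ and variance $\mathbb E|Z_n|^2=p_n$ (real and imaginary part independent, each with variance $p_n/2$); let $\mathrm{GA}(\rho)(d\psi)=\|\psi\|^2\,\mathrm G(\rho)(d\psi)$; then $\mathrm{GAP}(\rho)$ is the law of $\Psi/\|\Psi\|$ for a $\mathrm{GA}(\rho)$-distributed $\Psi$. Put $\psi_t=U_t\psi$, $\rho_t=U_t\,\rho\,U_t^*$ and $\tilde C=\frac{1}{2304\pi^2}$,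 and let $\|\cdot\|$ denote the operator norm. (For $B=0$ the quotients in the exponents below are read as $0$.) Then for every $\varepsilon\ge 0$ and every $t\ge 0$, $$\mathrm{GAP}(\rho)\Bigl\{\psi\in\mathbb S(\mathcal H): \bigl|\langle\psi_t|B|\psi_t\rangle-\operatorname{tr}(\rho_tB)\bigr|>\varepsilon\Bigr\}\le 12\exp\Bigl(-\frac{\tilde C\varepsilon^2}{\|B\|^2\|\rho\|}\Bigr).$$ Moreover, for every $\varepsilon>0$ and every $T>0$, $$\mathrm{GAP}(\rho)\Bigl\{\psi\in\mathbb S(\mathcal H): \frac1T\int_0^T\bigl|\langle\psi_t|B|\psi_t\rangle-\operatorname{tr}(\rho_tB)\bigr|\,dt>\varepsilon\Bigr\}\le 9\exp\Bigl(-\frac{\tilde C\varepsilon^2}{36\|B\|^2\|\rho\|}\Bigr).$$ -/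

import Mathlib

open MeasureTheory ProbabilityTheory
open scoped ENNReal NNReal

/-- `A` is a trace-class operator with trace `τ`: for every orthonormal basis `(eᵢ)` of `H` the
family `⟨eᵢ, A eᵢ⟩` is (unconditionally, hence absolutely) summable with sum `τ`. -/
def HasTrace {H : Type*} [NormedAddCommGroup H] [InnerProductSpace ℂ H]
    (A : H →L[ℂ] H) (τ : ℂ) : Prop :=
  ∀ (w : Set H) (e : HilbertBasis w ℂ H), HasSum (fun i => inner ℂ (e i) (A (e i))) τ

open Classical in
/-- The trace of a trace-class operator (`0` by convention for other operators). -/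
noncomputable def opTrace {H : Type*} [NormedAddCommGroup H] [InnerProductSpace ℂ H]
    (A : H →L[ℂ] H) : ℂ :=
  if h : ∃ τ, HasTrace A τ then h.choose else 0

/-- The trace is well defined: it equals any value that `HasTrace` assigns. -/
theorem HasTrace.opTrace_eq {H : Type*} [NormedAddCommGroup H] [InnerProductSpace ℂ H]
    [CompleteSpace H] {A : H →L[ℂ] H} {τ : ℂ} (h : HasTrace A τ) : opTrace A = τ := by
  have hex : ∃ τ, HasTrace A τ := ⟨τ, h⟩
  obtain ⟨w, b, -⟩ := exists_hilbertBasis ℂ H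
  rw [opTrace, dif_pos hex]
  exact (hex.choose_spec w b).unique (h w b)

/-- Density operators (density matrices): positive trace-class operators with trace `1`. -/
structure DensityOperator (H : Type*) [NormedAddCommGroup H] [InnerProductSpace ℂ H] where
  /-- The underlying bounded operator. -/
  op : H →L[ℂ] H
  isPositive : op.IsPositive
  hasTrace_one : HasTrace op 1

/-- A density operator is compact. -/
theorem DensityOperator.isCompactOperator {H : Type*} [NormedAddCommGroup H]
    [InnerProductSpace ℂ H] [CompleteSpace H] (ρ : DensityOperator H) :
    IsCompactOperator ρ.op := by
  classical
  obtain ⟨w, b, -⟩ := exists_hilbertBasis ℂ H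
  obtain ⟨S, hS⟩ := CStarAlgebra.nonneg_iff_eq_star_mul_self.1
    ((ContinuousLinearMap.nonneg_iff_isPositive ρ.op).2 ρ.isPositive)
  have hSx : ∀ x, inner ℂ x (ρ.op x) = ((‖S x‖ ^ 2 : ℝ) : ℂ) := by
    intro x
    rw [hS, mul_apply_eq_comp, ContinuousLinearMap.star_eq_adjoint,
      ContinuousLinearMap.adjoint_inner_right, inner_self_eq_norm_sq_to_K]
    push_cast; rfl
  have hsum : Summable fun i => ‖S (b i)‖ ^ 2 := by
    have := (ρ.hasTrace_one w b).summable
    simp only [hSx] at this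
    exact Complex.summable_ofReal.1 this
  -- truncations of `S` in the basis
  let F : Finset w → (H →L[ℂ] H) := fun s =>
    ∑ i ∈ s, (innerSL ℂ (b i)).smulRight (S (b i))
  have hFc : ∀ s, IsCompactOperator (F s) := by
    intro s
    have : F s ∈ compactOperator (RingHom.id ℂ) H H := by
      refine Submodule.sum_mem _ fun i _ => ?_
      change IsCompactOperator _
      have h1 : IsCompactOperator (innerSL ℂ (b i)) := by
        refine ⟨Metric.closedBall 0 1, isCompact_closedBall 0 1, ?_⟩
        exact (innerSL ℂ (b i)).continuous.continuousAt.preimage_mem_nhds (by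
          simpa using Metric.closedBall_mem_nhds (0 : ℂ) one_pos)
      exact h1.clm_comp ((ContinuousLinearMap.id ℂ ℂ).smulRight (S (b i)))
    exact this
  have hFS : Filter.Tendsto F Filter.atTop (nhds S) := by
    have hbound : ∀ s, ‖F s‖ ≤ √(∑ i ∈ s, ‖S (b i)‖ ^ 2) := by
      intro s
      refine ContinuousLinearMap.opNorm_le_bound _ (Real.sqrt_nonneg _) fun x => ?_
      have h1 : F s x = ∑ i ∈ s, inner ℂ (b i) x • S (b i) := by simp [F]
      calc ‖F s x‖ ≤ ∑ i ∈ s, ‖S (b i)‖ * ‖inner ℂ (b i) x‖ := by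
            rw [h1]
            refine (norm_sum_le _ _).trans (Finset.sum_le_sum fun i _ => ?_)
            rw [norm_smul, mul_comm]
        _ ≤ √(∑ i ∈ s, ‖S (b i)‖ ^ 2) * √(∑ i ∈ s, ‖inner ℂ (b i) x‖ ^ 2) :=
            Real.sum_mul_le_sqrt_mul_sqrt _ _ _
        _ ≤ √(∑ i ∈ s, ‖S (b i)‖ ^ 2) * ‖x‖ := by
            refine mul_le_mul_of_nonneg_left ?_ (Real.sqrt_nonneg _)
            refine (Real.sqrt_le_sqrt (b.orthonormal.sum_inner_products_le x)).trans ?_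
            rw [Real.sqrt_sq (norm_nonneg x)]
    have hF : Summable fun i => (innerSL ℂ (b i)).smulRight (S (b i)) := by
      rw [summable_iff_vanishing_norm]
      intro ε hε
      obtain ⟨s, hs⟩ := summable_iff_vanishing_norm.1 hsum (ε ^ 2) (by positivity)
      refine ⟨s, fun t ht => (hbound t).trans_lt ?_⟩
      rw [Real.sqrt_lt' hε]
      exact (le_abs_self _).trans_lt (hs t ht)
    obtain ⟨L, hL⟩ := hF
    have hLS : L = S := by
      ext x
      have h1 := (ContinuousLinearMap.apply ℂ H x).hasSum hL
      have h2 := S.hasSum (b.hasSum_repr x)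
      simp only [map_smul, b.repr_apply_apply] at h2
      exact h1.unique h2
    rw [← hLS]
    exact hL
  have hSc : IsCompactOperator S := isCompactOperator_of_tendsto hFS (.of_forall hFc)
  rw [hS]
  exact hSc.clm_comp (star S)

/-- Spectral theorem: a density operator has an orthonormal basis of eigenvectors, with
nonnegative eigenvalues. -/
theorem DensityOperator.exists_eigenbasis {H : Type*} [NormedAddCommGroup H]
    [InnerProductSpace ℂ H] [CompleteSpace H] (ρ : DensityOperator H) :
    ∃ (w : Set H) (e : HilbertBasis w ℂ H) (p : w → ℝ≥0),
      ∀ i, ρ.op (e i) = ((p i : ℝ) : ℂ) • e i := by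
  classical
  let T : H →ₗ[ℂ] H := ρ.op
  have hT : T.IsSymmetric := ρ.isPositive.1
  have hbot : (⨆ μ, Module.End.eigenspace T μ)ᗮ = ⊥ :=
    ContinuousLinearMap.orthogonalComplement_iSup_eigenspaces_eq_bot
      ρ.isCompactOperator ρ.isPositive.isSelfAdjoint.isSymmetric
  have hclosed : ∀ μ, CompleteSpace (Module.End.eigenspace T μ) := by
    intro μ
    have : IsClosed (Module.End.eigenspace T μ : Set H) := by
      have h : (Module.End.eigenspace T μ : Set H) = {x | ρ.op x = μ • x} := by
        ext x
        simp [T]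
      rw [h]
      exact isClosed_eq ρ.op.continuous (continuous_const_smul μ)
    exact this.completeSpace_coe
  choose w b hb using fun μ => exists_hilbertBasis ℂ (Module.End.eigenspace T μ)
  let v : (Σ μ, w μ) → H := fun a => (b a.1 a.2 : H)
  have hv : Orthonormal ℂ v :=
    hT.orthogonalFamily_eigenspaces.orthonormal_sigma_orthonormal fun μ => (b μ).orthonormal
  have hspan : (Submodule.span ℂ (Set.range ((↑) : Set.range v → H)))ᗮ = ⊥ := by
    rw [Subtype.range_coe, Submodule.eq_bot_iff]
    intro x hx
    have hx' : x ∈ (⨆ μ, Module.End.eigenspace T μ)ᗮ := by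
      rw [← Submodule.iInf_orthogonal, Submodule.mem_iInf]
      intro μ
      rw [Submodule.mem_orthogonal']
      intro y hy
      have h1 := (innerSL ℂ x ∘L (Module.End.eigenspace T μ).subtypeL).hasSum
        ((b μ).hasSum_repr ⟨y, hy⟩)
      have h2 : ∀ i, inner ℂ x (b μ i : H) = 0 := fun i =>
        (Submodule.mem_orthogonal' _ _).1 hx _ (Submodule.subset_span ⟨⟨μ, i⟩, rfl⟩)
      simp only [map_smul, ContinuousLinearMap.comp_apply, Submodule.subtypeL_apply,
        innerSL_apply_apply, h2, smul_zero] at h1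
      exact h1.unique hasSum_zero
    rw [hbot] at hx'
    exact hx'
  let e := HilbertBasis.mkOfOrthogonalEqBot hv.toSubtypeRange hspan
  have he : ∀ i, e i = (i : H) := fun i => by
    simp [e, HilbertBasis.coe_mkOfOrthogonalEqBot]
  refine ⟨Set.range v, e, fun i => (ρ.op.reApplyInnerSelf (e i)).toNNReal, fun i => ?_⟩
  obtain ⟨⟨μ, j⟩, hj⟩ := i.2
  have hx : e i = v ⟨μ, j⟩ := (he i).trans hj.symm
  have hmem : ρ.op (v ⟨μ, j⟩) = μ • v ⟨μ, j⟩ :=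
    Module.End.mem_eigenspace_iff.1 (b μ j).2
  have hnorm : inner ℂ (v ⟨μ, j⟩) (v ⟨μ, j⟩) = (1 : ℂ) := by
    rw [inner_self_eq_norm_sq_to_K, hv.1]
    simp
  have hconj : (starRingEnd ℂ) μ = μ := by
    have h : inner ℂ (ρ.op (v ⟨μ, j⟩)) (v ⟨μ, j⟩) = inner ℂ (v ⟨μ, j⟩) (ρ.op (v ⟨μ, j⟩)) :=
      ρ.isPositive.1 _ _
    rwa [hmem, inner_smul_left, inner_smul_right, hnorm, mul_one, mul_one] at h
  have hval : ρ.op.reApplyInnerSelf (v ⟨μ, j⟩) = μ.re := by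
    rw [ContinuousLinearMap.reApplyInnerSelf_apply, hmem, inner_smul_left, hnorm]
    simp
  have hnonneg : 0 ≤ μ.re := hval ▸ ρ.isPositive.2 (v ⟨μ, j⟩)
  simp only [hx, hval, Real.coe_toNNReal _ hnonneg, Complex.conj_eq_iff_re.1 hconj, hmem]

section GAP

variable {H : Type*} [NormedAddCommGroup H] [InnerProductSpace ℂ H] [CompleteSpace H]

/-- Index set of a chosen orthonormal eigenbasis of `ρ`. -/
def DensityOperator.eigenIndex (ρ : DensityOperator H) : Set H :=
  ρ.exists_eigenbasis.choose

/-- A chosen orthonormal eigenbasis of `ρ`. -/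
noncomputable def DensityOperator.eigenbasis (ρ : DensityOperator H) :
    HilbertBasis ρ.eigenIndex ℂ H :=
  ρ.exists_eigenbasis.choose_spec.choose

/-- The eigenvalues of `ρ` that belong to the chosen eigenbasis. -/
noncomputable def DensityOperator.eigenvalue (ρ : DensityOperator H) : ρ.eigenIndex → ℝ≥0 :=
  ρ.exists_eigenbasis.choose_spec.choose_spec.choose

theorem DensityOperator.op_eigenbasis (ρ : DensityOperator H) (i : ρ.eigenIndex) :
    ρ.op (ρ.eigenbasis i) = ((ρ.eigenvalue i : ℝ) : ℂ) • ρ.eigenbasis i :=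
  ρ.exists_eigenbasis.choose_spec.choose_spec.choose_spec i

/-- The law of a complex Gaussian random variable with mean `0` and variance `v`: real and
imaginary part are independent real Gaussians with mean `0` and variance `v / 2`. -/
noncomputable def complexGaussian (v : ℝ≥0) : Measure ℂ :=
  ((gaussianReal 0 (v / 2)).prod (gaussianReal 0 (v / 2))).map Complex.measurableEquivRealProd.symm

instance complexGaussian.isProbabilityMeasure (v : ℝ≥0) :
    IsProbabilityMeasure (complexGaussian v) :=
  Measure.isProbabilityMeasure_map Complex.measurableEquivRealProd.symm.measurable.aemeasurable

variable [MeasurableSpace H]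

/-- The Gaussian measure `G(ρ)` with mean `0` and covariance operator `ρ`: the law of the random
vector `∑ n, Z n • e n`, where `e` is an orthonormal eigenbasis of `ρ` with eigenvalues `p n` and
the `Z n` are independent complex Gaussians with mean `0` and variance `p n`. -/
noncomputable def gaussianG (ρ : DensityOperator H) : Measure H :=
  (Measure.infinitePi fun n => complexGaussian (ρ.eigenvalue n)).map
    fun z => ∑' n, z n • ρ.eigenbasis n

/-- The adjusted Gaussian measure `GA(ρ)`, with density `‖ψ‖²` relative to `G(ρ)`. -/
noncomputable def gaussianGA (ρ : DensityOperator H) : Measure H :=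
  (gaussianG ρ).withDensity fun ψ => ENNReal.ofReal (‖ψ‖ ^ 2)

/-- The measure `GAP(ρ)` on the unit sphere: the law of `Ψ / ‖Ψ‖` for a `GA(ρ)`-distributed
random vector `Ψ` (which is nonzero almost surely, so that `Ψ / ‖Ψ‖` is in the sphere). -/
noncomputable def GAP (ρ : DensityOperator H) : Measure (Metric.sphere (0 : H) 1) :=
  ((gaussianGA ρ).map fun ψ => ((‖ψ‖⁻¹ : ℝ) : ℂ) • ψ).comap Subtype.val

end GAP

/-- A family `(U t)`, `t ≥ 0`, of unitary operators is measurable if `t ↦ U t φ` is measurable on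
`[0, ∞)` for every vector `φ`. -/
def IsMeasurableFamily {H : Type*} [NormedAddCommGroup H] [InnerProductSpace ℂ H]
    [CompleteSpace H] [MeasurableSpace H] (U : ℝ → unitary (H →L[ℂ] H)) : Prop :=
  ∀ φ : H, Measurable fun t : Set.Ici (0 : ℝ) => (U t : H →L[ℂ] H) φ

/-! Conjugation moves the dynamics onto the observable: with C = U_t* B U_t the deviation is ⟨ψ, Cψ⟩
- tr(ρC), and ‖C‖ = ‖B‖ (`inner_apply_sub_opTrace`). Hence one moment bound, uniform over operators
C with ‖C‖ ≤ b, suffices: E exp(a X²) ≤ 9 for the deviation X, with a = 1/(2304 π² b² ‖ρ‖)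
(`lintegral_exp_sq_GAP_le`). Markov's inequality gives the fixed-time estimate. Jensen's inequality
for exp(a x²) and Tonelli carry the same moment over to time averages, so the loss of 36 in the
exponent is not needed.

The moment bound comes from a Chernoff argument on the Gaussian side (`GAP_re_inner_tail`). Before
normalization, the event Re⟨ψ, Cψ⟩ > m reads Re⟨ψ, Cψ⟩ > m‖ψ‖². Its indicator is at most exp(s(Re⟨ψ,
Cψ⟩ - m‖ψ‖²)), and the density ‖ψ‖² is at most exp(‖ψ‖² - 1). Both exponents are quadratic, so the
probability is at most e⁻¹ E exp⟨ψ, Mψ⟩ with M = s(Re C - m) + 1 under G(ρ). By diagonalization in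
finite dimension and Fatou's lemma, this expectation is at most exp(tr(ρM) + ‖ρ‖‖M‖²) when ‖ρ‖‖M‖ ≤
1/2 (`lintegral_exp_quadraticForm_gaussianG_le`). Optimizing s gives a Gaussian tail with a constant
well above the required one, which leaves room to integrate it into the square-exponential moment.
-/

/-! ### Exponential moments of finite-dimensional complex Gaussians -/

theorem charFun_complexGaussian (v : ℝ≥0) (t : ℂ) :
    charFun (complexGaussian v) t = Complex.exp (-(v * ‖t‖ ^ 2 / 4 : ℝ)) := by
  have h (a : ℝ) : ∫ x, Complex.exp (x * a * Complex.I) ∂(gaussianReal 0 (v / 2))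
      = Complex.exp (-(v * a ^ 2 / 4 : ℝ)) := by
    have := charFun_gaussianReal (μ := 0) (v := v / 2) a
    rw [charFun_apply_real] at this
    convert this using 2
    · ext x; ring_nf
    · push_cast; ring_nf
  rw [charFun_apply, complexGaussian, integral_map_equiv]
  have : ∀ z : ℝ × ℝ, Complex.exp
      (inner ℝ (Complex.measurableEquivRealProd.symm z) t * Complex.I)
      = Complex.exp (z.1 * t.re * Complex.I) * Complex.exp (z.2 * t.im * Complex.I) := by
    intro z
    rw [← Complex.exp_add]
    congr 1
    simp [Complex.measurableEquivRealProd, Complex.inner]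
    ring
  simp_rw [this]
  rw [integral_prod_mul (fun x : ℝ => Complex.exp (x * t.re * Complex.I))
    (fun x : ℝ => Complex.exp (x * t.im * Complex.I)), h, h, ← Complex.exp_add, ← Complex.ofReal_neg,
    ← Complex.ofReal_neg, ← Complex.ofReal_neg, ← Complex.ofReal_add, ← Complex.normSq_eq_norm_sq,
    Complex.normSq_apply]
  congr 2
  ring

/-- At variance 1/2 the density is exp(-x²)/√π, so the weight only changes the rate from 1 to 1 - l.
Real and imaginary parts together then contribute the square of this value, (1 - l)⁻¹. -/
theorem integrable_exp_mul_sq_gaussianReal {l : ℝ} (hl : l < 1) :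
    Integrable (fun x : ℝ => Real.exp (l * x ^ 2)) (gaussianReal 0 (1 / 2)) ∧
      ∫ x, Real.exp (l * x ^ 2) ∂(gaussianReal 0 (1 / 2)) = (√(1 - l))⁻¹ := by
  have hv : (1 / 2 : ℝ≥0) ≠ 0 := by norm_num
  have hpdf : ∀ x, gaussianPDFReal 0 (1 / 2) x * Real.exp (l * x ^ 2)
      = (√Real.pi)⁻¹ * Real.exp (-(1 - l) * x ^ 2) := by
    intro x
    rw [gaussianPDFReal, mul_assoc, ← Real.exp_add]
    congr 2
    · push_cast; ring_nf
    · push_cast; ring_nf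
  constructor
  · rw [gaussianReal_of_var_ne_zero _ hv, integrable_withDensity_iff (by fun_prop)
      (.of_forall fun _ => gaussianPDF_lt_top)]
    have h1 : ∀ x, Real.exp (l * x ^ 2) * (gaussianPDF 0 (1 / 2) x).toReal
        = (√Real.pi)⁻¹ * Real.exp (-(1 - l) * x ^ 2) := by
      intro x
      rw [toReal_gaussianPDF, mul_comm, hpdf]
    simp_rw [h1]
    exact (integrable_exp_neg_mul_sq (by linarith)).const_mul _
  · rw [integral_gaussianReal_eq_integral_smul hv]
    simp_rw [smul_eq_mul, hpdf]
    rw [integral_const_mul, integral_gaussian, Real.sqrt_div Real.pi_pos.le, div_eq_mul_inv,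
      ← mul_assoc, inv_mul_cancel₀ (by positivity), one_mul]

theorem integrable_exp_mul_normSq_complexGaussian {l : ℝ} (hl : l < 1) :
    Integrable (fun z : ℂ => Real.exp (l * ‖z‖ ^ 2)) (complexGaussian 1) ∧
      ∫ z, Real.exp (l * ‖z‖ ^ 2) ∂(complexGaussian 1) = (1 - l)⁻¹ := by
  obtain ⟨h1, h2⟩ := integrable_exp_mul_sq_gaussianReal hl
  have h3 : ∀ z : ℝ × ℝ, Real.exp (l * ‖Complex.measurableEquivRealProd.symm z‖ ^ 2)
      = Real.exp (l * z.1 ^ 2) * Real.exp (l * z.2 ^ 2) := by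
    intro z
    rw [← Real.exp_add, ← Complex.normSq_eq_norm_sq, Complex.normSq_apply]
    simp [Complex.measurableEquivRealProd]
    ring
  constructor
  · rw [complexGaussian, integrable_map_equiv]
    simp only [Function.comp_def, h3]
    exact h1.mul_prod h1
  · rw [complexGaussian, integral_map_equiv]
    simp only [h3]
    rw [integral_prod_mul (fun x : ℝ => Real.exp (l * x ^ 2)) (fun x : ℝ => Real.exp (l * x ^ 2)), h2, ← mul_inv,
      Real.mul_self_sqrt (by linarith)]

/-- For l ≤ 0 the bound exp u ≥ 1 + u is enough, since (1 - l)(1 + l + l²) = 1 - l³ ≥ 1. For l ≥ 0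
the quadratic Taylor term is needed, and 1 - 2l ≥ 0 enters. Summed over eigenvalues, l becomes a
trace and l² a squared Hilbert–Schmidt norm. -/
theorem inv_one_sub_le_exp {l : ℝ} (h : |l| ≤ 1 / 2) : (1 - l)⁻¹ ≤ Real.exp (l + l ^ 2) := by
  obtain ⟨h1, h2⟩ := abs_le.1 h
  rw [inv_le_iff_one_le_mul₀ (by linarith)]
  rcases le_total l 0 with hl | hl
  · have := Real.add_one_le_exp (l + l ^ 2)
    have h3 : 0 ≤ -l ^ 3 := by
      have : 0 ≤ (-l) ^ 3 := pow_nonneg (by linarith) _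
      linarith [this, show (-l) ^ 3 = -l ^ 3 by ring]
    nlinarith
  · have := Real.quadratic_le_exp_of_nonneg (x := l + l ^ 2) (by positivity)
    have h3 : 1 ≤ (1 - l) * (1 + (l + l ^ 2) + (l + l ^ 2) ^ 2 / 2) := by
      have h4 : (1 - l) * (1 + (l + l ^ 2) + (l + l ^ 2) ^ 2 / 2) - 1
        = l ^ 2 * ((1 - 2 * l) * (1 + l) + l ^ 2 * (1 - l)) / 2 := by ring
      have h5 : 0 ≤ (1 - 2 * l) * (1 + l) := mul_nonneg (by linarith) (by linarith)
      have h6 : 0 ≤ 1 - l := by linarith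
      have : 0 ≤ l ^ 2 * ((1 - 2 * l) * (1 + l) + l ^ 2 * (1 - l)) / 2 := by positivity
      linarith
    have h6 : 0 ≤ 1 - l := by linarith
    nlinarith [mul_le_mul_of_nonneg_left this h6]

/-- The law of a vector of independent standard complex Gaussians. -/
noncomputable def stdComplexGaussian (ι : Type*) [Fintype ι] : Measure (EuclideanSpace ℂ ι) :=
  (Measure.pi fun _ : ι => complexGaussian 1).map (WithLp.toLp 2)

instance (ι : Type*) [Fintype ι] : IsProbabilityMeasure (stdComplexGaussian ι) :=
  Measure.isProbabilityMeasure_map (by fun_prop)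

theorem charFun_stdComplexGaussian {ι : Type*} [Fintype ι] (t : EuclideanSpace ℂ ι) :
    charFun (stdComplexGaussian ι) t = Complex.exp (-(‖t‖ ^ 2 / 4 : ℝ)) := by
  rw [stdComplexGaussian, charFun_pi]
  simp_rw [charFun_complexGaussian]
  rw [← Complex.exp_sum, EuclideanSpace.norm_sq_eq]
  congr 1
  push_cast
  simp [Finset.sum_div]

/-- The characteristic function depends on the norm alone. Two index types are allowed because an
eigenbasis is indexed by `Fin n` rather than by the original coordinates. -/
theorem stdComplexGaussian_map_isometry {ι κ : Type*} [Fintype ι] [Fintype κ]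
    (V : EuclideanSpace ℂ ι ≃ₗᵢ[ℂ] EuclideanSpace ℂ κ) :
    (stdComplexGaussian ι).map V = stdComplexGaussian κ := by
  have : IsProbabilityMeasure ((stdComplexGaussian ι).map V) :=
    Measure.isProbabilityMeasure_map V.continuous.measurable.aemeasurable
  refine Measure.ext_of_charFun ?_
  ext t
  rw [charFun_stdComplexGaussian, charFun_apply,
    integral_map V.continuous.measurable.aemeasurable (by fun_prop)]
  -- Polarization: the real inner product is a function of norms, which V preserves.
  have h : ∀ x : EuclideanSpace ℂ ι, inner ℝ (V x) t = inner ℝ x (V.symm t) := by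
    intro x
    conv_lhs => rw [← V.apply_symm_apply t]
    rw [real_inner_eq_norm_mul_self_add_norm_mul_self_sub_norm_sub_mul_self_div_two,
      real_inner_eq_norm_mul_self_add_norm_mul_self_sub_norm_sub_mul_self_div_two, ← map_sub]
    simp only [LinearIsometryEquiv.norm_map]
  simp_rw [h]
  rw [← charFun_apply, charFun_stdComplexGaussian, LinearIsometryEquiv.norm_map]

theorem lintegral_exp_sum_mul_normSq {ι : Type*} [Fintype ι] (l : ι → ℝ)
    (hl : ∀ i, |l i| ≤ 1 / 2) :
    ∫⁻ x, ENNReal.ofReal (Real.exp (∑ i, l i * ‖x i‖ ^ 2)) ∂(stdComplexGaussian ι)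
      ≤ ENNReal.ofReal (Real.exp (∑ i, l i + ∑ i, l i ^ 2)) := by
  have hl1 : ∀ i, l i < 1 := fun i => by linarith [(abs_le.1 (hl i)).2]
  rw [stdComplexGaussian, lintegral_map (by fun_prop) (by fun_prop)]
  simp only [Real.exp_sum]
  rw [← ofReal_integral_eq_lintegral_ofReal
    (Integrable.fintype_prod (f := fun i (z : ℂ) => Real.exp (l i * ‖z‖ ^ 2))
      fun i => (integrable_exp_mul_normSq_complexGaussian (hl1 i)).1)
    (.of_forall fun x => Finset.prod_nonneg fun i _ => (Real.exp_pos _).le),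
    integral_fintype_prod_eq_prod (f := fun i (z : ℂ) => Real.exp (l i * ‖z‖ ^ 2)),
    ← Finset.sum_add_distrib, Real.exp_sum]
  refine ENNReal.ofReal_le_ofReal (Finset.prod_le_prod (fun i _ => integral_nonneg fun _ => (Real.exp_pos _).le) fun i _ => ?_)
  rw [(integrable_exp_mul_normSq_complexGaussian (hl1 i)).2]
  exact inv_one_sub_le_exp (hl i)

/-- Exponential moment of a quadratic form in a standard complex Gaussian vector. -/
theorem lintegral_exp_quadraticForm_le {ι : Type*} [Fintype ι] [DecidableEq ι]
    (T : EuclideanSpace ℂ ι →L[ℂ] EuclideanSpace ℂ ι) (hT : (T : EuclideanSpace ℂ ι →ₗ[ℂ] EuclideanSpace ℂ ι).IsSymmetric)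
    (hn : ‖T‖ ≤ 1 / 2) :
    ∫⁻ x, ENNReal.ofReal (Real.exp (inner ℂ x (T x)).re) ∂(stdComplexGaussian ι)
      ≤ ENNReal.ofReal (Real.exp (∑ i, (inner ℂ (EuclideanSpace.single i 1)
            (T (EuclideanSpace.single i 1))).re
          + ∑ i, ‖T (EuclideanSpace.single i (1 : ℂ))‖ ^ 2)) := by
  let b := hT.eigenvectorBasis rfl
  let l := hT.eigenvalues rfl
  have hb : ∀ i, T (b i) = (l i : ℂ) • b i := fun i => hT.apply_eigenvectorBasis rfl i
  have hl : ∀ i, |l i| ≤ 1 / 2 := by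
    intro i
    have h1 := T.le_opNorm (b i)
    rw [hb, norm_smul, b.norm_eq_one] at h1
    simp at h1
    linarith
  have hdiag : ∀ x, (inner ℂ x (T x)).re = ∑ i, l i * ‖b.repr x i‖ ^ 2 := by
    intro x
    rw [← b.sum_inner_mul_inner, Complex.re_sum]
    refine Finset.sum_congr rfl fun i _ => ?_
    have : inner ℂ (b i) (T x) = l i * inner ℂ (b i) x := by
      have h := hT (b i) x
      change inner ℂ (T (b i)) x = inner ℂ (b i) (T x) at h
      rw [← h, hb, inner_smul_left]; simp
    rw [this, b.repr_apply_apply, ← inner_conj_symm x (b i), mul_left_comm, ← Complex.normSq_eq_conj_mul_self,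
      Complex.normSq_eq_norm_sq, ← Complex.ofReal_mul, Complex.ofReal_re]
  -- Basis independence of the trace, used for T and for T², turns ∑ l and ∑ l² into sums over the
  -- standard basis.
  have htr : ∀ S : EuclideanSpace ℂ ι →L[ℂ] EuclideanSpace ℂ ι, ∑ i, inner ℂ (b i) (S (b i)) =
      ∑ i, inner ℂ (EuclideanSpace.single i 1) (S (EuclideanSpace.single i 1)) := by
    intro S
    have h1 := (S : EuclideanSpace ℂ ι →ₗ[ℂ] EuclideanSpace ℂ ι).trace_eq_sum_inner b
    have h2 := (S : EuclideanSpace ℂ ι →ₗ[ℂ] EuclideanSpace ℂ ι).trace_eq_sum_inner (EuclideanSpace.basisFun ι ℂ)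
    simpa using h1.symm.trans h2
  have hsum1 : ∑ i, l i = ∑ i, (inner ℂ (EuclideanSpace.single i 1)
      (T (EuclideanSpace.single i 1))).re := by
    rw [← Complex.re_sum, ← htr T, Complex.re_sum]
    refine Finset.sum_congr rfl fun i _ => ?_
    rw [hb, inner_smul_right, b.inner_eq_one]; simp
  have hsum2 : ∑ i, l i ^ 2 = ∑ i, ‖T (EuclideanSpace.single i (1 : ℂ))‖ ^ 2 := by
    have h3 := htr (T ∘L T)
    have h4 : ∀ y, inner ℂ y ((T ∘L T) y) = ((‖T y‖ ^ 2 : ℝ) : ℂ) := by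
      intro y
      have := hT y (T y)
      change inner ℂ (T y) (T y) = inner ℂ y (T (T y)) at this
      rw [ContinuousLinearMap.comp_apply, ← this, inner_self_eq_norm_sq_to_K]
      simp
    simp only [h4] at h3
    rw [← Complex.ofReal_sum, ← Complex.ofReal_sum, Complex.ofReal_inj] at h3
    rw [← h3]
    refine Finset.sum_congr rfl fun i _ => ?_
    rw [hb, norm_smul, b.norm_eq_one]; simp
  rw [← hsum1, ← hsum2]
  refine le_trans (le_of_eq ?_) (lintegral_exp_sum_mul_normSq l hl)
  rw [← stdComplexGaussian_map_isometry b.repr, lintegral_map (by fun_prop)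
    b.repr.continuous.measurable]
  simp_rw [hdiag]

/-! ### Hilbert bases, the expectation in an eigenbasis, and truncations of G(ρ) -/

/-- Distinct basis vectors are at distance √2, so balls of radius 1/2 around them are disjoint open
sets. -/
theorem HilbertBasis.countable_of_separable {ι H : Type*} [NormedAddCommGroup H]
    [InnerProductSpace ℂ H] [TopologicalSpace.SeparableSpace H] (e : HilbertBasis ι ℂ H) :
    Countable ι := by
  refine Pairwise.countable_of_isOpen_disjoint (s := fun i => Metric.ball (e i) (1 / 2)) ?_
    (fun i => Metric.isOpen_ball) (fun i => ⟨e i, Metric.mem_ball_self (by norm_num)⟩)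
  intro i j hij
  refine Metric.ball_disjoint_ball ?_
  have h1 := norm_sub_sq (𝕜 := ℂ) (e i) (e j)
  rw [e.orthonormal.1, e.orthonormal.1, e.orthonormal.2 hij] at h1
  norm_num at h1
  rw [dist_eq_norm]
  nlinarith [norm_nonneg (e i - e j)]

theorem HilbertBasis.norm_inner_apply_le {ι H : Type*} [NormedAddCommGroup H]
    [InnerProductSpace ℂ H] (e : HilbertBasis ι ℂ H) (A : H →L[ℂ] H)
    (i : ι) : ‖inner ℂ (e i) (A (e i))‖ ≤ ‖A‖ := by
  refine (norm_inner_le_norm _ _).trans ?_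
  have := A.le_opNorm (e i)
  rw [e.orthonormal.1] at this ⊢
  linarith

theorem map_mul_complexGaussian_one (v : ℝ≥0) :
    (complexGaussian 1).map (fun z => ((√(v : ℝ) : ℝ) : ℂ) * z) = complexGaussian v := by
  have : IsProbabilityMeasure ((complexGaussian 1).map (fun z => ((√(v : ℝ) : ℝ) : ℂ) * z)) :=
    Measure.isProbabilityMeasure_map (by fun_prop)
  refine Measure.ext_of_charFun ?_
  ext t
  have h := charFun_map_smul (μ := complexGaussian 1) (√(v : ℝ)) t
  simp only [Complex.real_smul] at h
  rw [h, charFun_complexGaussian, charFun_complexGaussian]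
  simp [mul_pow]

theorem lintegral_normSq_complexGaussian (v : ℝ≥0) :
    ∫⁻ z, ENNReal.ofReal (‖z‖ ^ 2) ∂(complexGaussian v) = v := by
  have h2 : Integrable (fun x : ℝ => x ^ 2) (gaussianReal 0 (v / 2)) :=
    (memLp_id_gaussianReal 2).integrable_sq
  have h3 : ∫ x, x ^ 2 ∂(gaussianReal 0 (v / 2)) = v / 2 := by
    have := variance_id_gaussianReal (μ := 0) (v := v / 2)
    rw [variance_eq_integral measurable_id.aemeasurable] at this
    simpa using this
  have h4 : ∫⁻ x, ENNReal.ofReal (x ^ 2) ∂(gaussianReal 0 (v / 2)) = ENNReal.ofReal (v / 2) := by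
    rw [← ofReal_integral_eq_lintegral_ofReal h2 (.of_forall fun x => sq_nonneg x), h3]
  have h5 : ∀ z : ℝ × ℝ, ENNReal.ofReal (‖Complex.measurableEquivRealProd.symm z‖ ^ 2)
      = ENNReal.ofReal (z.1 ^ 2) + ENNReal.ofReal (z.2 ^ 2) := by
    intro z
    rw [← Complex.normSq_eq_norm_sq, Complex.normSq_apply,
      ← ENNReal.ofReal_add (sq_nonneg _) (sq_nonneg _)]
    simp [Complex.measurableEquivRealProd, sq]
  rw [complexGaussian, lintegral_map_equiv]
  simp only [h5]
  rw [lintegral_add_left (by fun_prop), lintegral_prod _ (by fun_prop),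
    lintegral_prod _ (by fun_prop)]
  simp only [lintegral_const, measure_univ, mul_one, h4]
  rw [← ENNReal.ofReal_add (by positivity) (by positivity), add_halves]
  simp

section

variable {H : Type*} [NormedAddCommGroup H] [InnerProductSpace ℂ H] [CompleteSpace H]

theorem DensityOperator.hasSum_eigenvalue (ρ : DensityOperator H) :
    HasSum (fun i => (ρ.eigenvalue i : ℝ)) 1 := by
  have h := ρ.hasTrace_one _ ρ.eigenbasis
  have h1 : ∀ i, inner ℂ (ρ.eigenbasis i) (ρ.op (ρ.eigenbasis i)) = ((ρ.eigenvalue i : ℝ) : ℂ) := by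
    intro i
    rw [ρ.op_eigenbasis, inner_smul_right, inner_self_eq_norm_sq_to_K,
      ρ.eigenbasis.orthonormal.1]
    simp
  simp only [h1] at h
  rw [← Complex.ofReal_one] at h
  exact Complex.hasSum_ofReal.1 h

theorem DensityOperator.eigenvalue_le (ρ : DensityOperator H) (i : ρ.eigenIndex) :
    (ρ.eigenvalue i : ℝ) ≤ ‖ρ.op‖ := by
  have h := ρ.op.le_opNorm (ρ.eigenbasis i)
  rw [ρ.op_eigenbasis, norm_smul, ρ.eigenbasis.orthonormal.1] at h
  simpa using h

theorem DensityOperator.norm_op_pos (ρ : DensityOperator H) : 0 < ‖ρ.op‖ := by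
  rw [norm_pos_iff]
  intro h
  have h1 : ∀ i, (ρ.eigenvalue i : ℝ) = 0 := fun i =>
    le_antisymm (by simpa [h] using ρ.eigenvalue_le i) (ρ.eigenvalue i).2
  have h2 := ρ.hasSum_eigenvalue
  simp only [h1] at h2
  exact one_ne_zero (h2.unique hasSum_zero)

/-- The expectation `tr(ρ A)`, computed in the eigenbasis of `ρ`. -/
noncomputable def DensityOperator.expect (ρ : DensityOperator H) (A : H →L[ℂ] H) : ℂ :=
  ∑' i, (ρ.eigenvalue i : ℂ) * inner ℂ (ρ.eigenbasis i) (A (ρ.eigenbasis i))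

theorem DensityOperator.norm_expect_term_le (ρ : DensityOperator H) (A : H →L[ℂ] H)
    (i : ρ.eigenIndex) :
    ‖(ρ.eigenvalue i : ℂ) * inner ℂ (ρ.eigenbasis i) (A (ρ.eigenbasis i))‖
      ≤ ρ.eigenvalue i * ‖A‖ := by
  rw [norm_mul]
  gcongr
  · simp
  · exact ρ.eigenbasis.norm_inner_apply_le A i

theorem DensityOperator.hasSum_expect (ρ : DensityOperator H) (A : H →L[ℂ] H) :
    HasSum (fun i => (ρ.eigenvalue i : ℂ) * inner ℂ (ρ.eigenbasis i) (A (ρ.eigenbasis i)))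
      (ρ.expect A) :=
  (Summable.of_norm_bounded (ρ.hasSum_eigenvalue.mul_right ‖A‖).summable
    (ρ.norm_expect_term_le A)).hasSum

theorem DensityOperator.norm_expect_le (ρ : DensityOperator H) (A : H →L[ℂ] H) :
    ‖ρ.expect A‖ ≤ ‖A‖ := by
  have h := ρ.hasSum_eigenvalue.mul_right ‖A‖
  rw [one_mul] at h
  exact tsum_of_norm_bounded h (ρ.norm_expect_term_le A)

theorem DensityOperator.norm_inner_sub_expect_le (ρ : DensityOperator H) (B : H →L[ℂ] H)
    (ψ : Metric.sphere (0 : H) 1) : ‖inner ℂ (ψ : H) (B ψ) - ρ.expect B‖ ≤ 2 * ‖B‖ := by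
  have h1 : ‖(ψ : H)‖ = 1 := by simp
  have h2 : ‖inner ℂ (ψ : H) (B ψ)‖ ≤ ‖B‖ := by
    refine (norm_inner_le_norm _ _).trans ?_
    have := B.le_opNorm (ψ : H)
    rw [h1] at this ⊢
    linarith
  linarith [norm_sub_le (inner ℂ (ψ : H) (B ψ)) (ρ.expect B), ρ.norm_expect_le B]

theorem DensityOperator.expect_add (ρ : DensityOperator H) (A B : H →L[ℂ] H) :
    ρ.expect (A + B) = ρ.expect A + ρ.expect B := by
  refine (ρ.hasSum_expect (A + B)).unique ?_
  simp only [add_apply, inner_add_right, mul_add]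
  exact (ρ.hasSum_expect A).add (ρ.hasSum_expect B)

theorem DensityOperator.expect_smul (ρ : DensityOperator H) (c : ℂ) (A : H →L[ℂ] H) :
    ρ.expect (c • A) = c * ρ.expect A := by
  refine (ρ.hasSum_expect (c • A)).unique ?_
  simp only [smul_apply, inner_smul_right, mul_left_comm _ c]
  exact (ρ.hasSum_expect A).mul_left c

theorem DensityOperator.expect_one (ρ : DensityOperator H) : ρ.expect 1 = 1 := by
  refine (ρ.hasSum_expect 1).unique ?_
  rw [← Complex.ofReal_one]
  simp only [one_apply_eq_self, inner_self_eq_norm_sq_to_K, ρ.eigenbasis.orthonormal.1]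
  simpa using Complex.hasSum_ofReal.2 ρ.hasSum_eigenvalue

theorem DensityOperator.expect_adjoint (ρ : DensityOperator H) (A : H →L[ℂ] H) :
    ρ.expect (ContinuousLinearMap.adjoint A) = (starRingEnd ℂ) (ρ.expect A) := by
  refine (ρ.hasSum_expect _).unique ?_
  simpa only [ContinuousLinearMap.adjoint_inner_right, map_mul, inner_conj_symm,
    Complex.conj_ofReal] using Complex.hasSum_conj'.2 (ρ.hasSum_expect A)

/-- The map `x ↦ ∑ i ∈ s, √(p i) x i e i` that carries standard complex Gaussian vectors to
truncations of `G(ρ)`-distributed vectors. -/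
noncomputable def DensityOperator.sqrtEmbed (ρ : DensityOperator H) (s : Finset ρ.eigenIndex) :
    EuclideanSpace ℂ s →L[ℂ] H :=
  ∑ i : s, (EuclideanSpace.proj i : EuclideanSpace ℂ s →L[ℂ] ℂ).smulRight
    (((√(ρ.eigenvalue i : ℝ) : ℝ) : ℂ) • ρ.eigenbasis i)

theorem DensityOperator.sqrtEmbed_apply (ρ : DensityOperator H) (s : Finset ρ.eigenIndex)
    (x : EuclideanSpace ℂ s) :
    ρ.sqrtEmbed s x = ∑ i : s, (((√(ρ.eigenvalue i : ℝ) : ℝ) : ℂ) * x i) • ρ.eigenbasis i := by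
  rw [sqrtEmbed, sum_apply]
  refine Finset.sum_congr rfl fun i _ => ?_
  rw [ContinuousLinearMap.smulRight_apply, smul_smul, mul_comm]
  rfl

theorem DensityOperator.norm_sqrtEmbed_le (ρ : DensityOperator H) (s : Finset ρ.eigenIndex) :
    ‖ρ.sqrtEmbed s‖ ≤ √‖ρ.op‖ := by
  refine ContinuousLinearMap.opNorm_le_bound _ (Real.sqrt_nonneg _) fun x => ?_
  refine le_of_sq_le_sq ?_ (by positivity)
  have h := (ρ.eigenbasis.orthonormal.comp ((↑) : s → ρ.eigenIndex)
    Subtype.val_injective).inner_sum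
    (fun i : s => ((√(ρ.eigenvalue i : ℝ) : ℝ) : ℂ) * x i)
    (fun i : s => ((√(ρ.eigenvalue i : ℝ) : ℝ) : ℂ) * x i) Finset.univ
  simp only [Function.comp_def] at h
  rw [← ρ.sqrtEmbed_apply, inner_self_eq_norm_sq_to_K] at h
  have h2 : ‖ρ.sqrtEmbed s x‖ ^ 2 = ∑ i : s, (ρ.eigenvalue i : ℝ) * ‖x i‖ ^ 2 := by
    have h3 : (((‖ρ.sqrtEmbed s x‖ ^ 2 : ℝ)) : ℂ) = ((∑ i : s, (ρ.eigenvalue i : ℝ) * ‖x i‖ ^ 2 : ℝ) : ℂ) := by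
      push_cast
      refine Eq.trans h (Finset.sum_congr rfl fun i _ => ?_)
      rw [← Complex.normSq_eq_conj_mul_self, Complex.normSq_eq_norm_sq, norm_mul, mul_pow]
      simp
    exact_mod_cast h3
  rw [h2, mul_pow, Real.sq_sqrt (norm_nonneg _), EuclideanSpace.norm_sq_eq, Finset.mul_sum]
  gcongr
  exact ρ.eigenvalue_le _

theorem DensityOperator.measurable_truncation (ρ : DensityOperator H) [MeasurableSpace H]
    [BorelSpace H] (s : Finset ρ.eigenIndex) :
    Measurable fun z : ρ.eigenIndex → ℂ => ∑ i ∈ s, z i • ρ.eigenbasis i := by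
  have h : Measurable (fun y : s → ℂ => ∑ i : s, y i • ρ.eigenbasis i) :=
    Continuous.measurable (by fun_prop)
  have h1 : (fun z : ρ.eigenIndex → ℂ => ∑ i ∈ s, z i • ρ.eigenbasis i)
      = (fun y : s → ℂ => ∑ i : s, y i • ρ.eigenbasis i) ∘ s.restrict := by
    ext z
    simp [Finset.restrict, ← Finset.sum_coe_sort s]
  rw [h1]
  exact h.comp (by fun_prop)

/-- Rescaling each coordinate by √p reduces truncations to the standard Gaussian, where unitary
invariance is available. -/
theorem DensityOperator.map_truncation (ρ : DensityOperator H) [MeasurableSpace H] [BorelSpace H]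
    (s : Finset ρ.eigenIndex) :
    (Measure.infinitePi fun n => complexGaussian (ρ.eigenvalue n)).map
        (fun z => ∑ i ∈ s, z i • ρ.eigenbasis i)
      = (stdComplexGaussian s).map (ρ.sqrtEmbed s) := by
  have h1 : (fun z : ρ.eigenIndex → ℂ => ∑ i ∈ s, z i • ρ.eigenbasis i)
      = (fun y : s → ℂ => ∑ i : s, y i • ρ.eigenbasis i) ∘ s.restrict := by
    ext z
    simp [Finset.restrict, ← Finset.sum_coe_sort s]
  have hm : Measurable (fun y : s → ℂ => ∑ i : s, y i • ρ.eigenbasis i) :=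
    Continuous.measurable (by fun_prop)
  have h2 : (Measure.pi fun i : s => complexGaussian (ρ.eigenvalue i))
      = (Measure.pi fun _ : s => complexGaussian 1).map
        (fun x (i : s) => ((√(ρ.eigenvalue i : ℝ) : ℝ) : ℂ) * x i) := by
    simp_rw [← map_mul_complexGaussian_one (ρ.eigenvalue _)]
    have (i : s) : SigmaFinite ((complexGaussian 1).map
      (fun z => ((√(ρ.eigenvalue i : ℝ) : ℝ) : ℂ) * z)) := by
      rw [map_mul_complexGaussian_one]; infer_instance
    rw [Measure.pi_map_pi (μ := fun _ : s => complexGaussian 1)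
      (f := fun i z => ((√(ρ.eigenvalue i : ℝ) : ℝ) : ℂ) * z) (fun i => by fun_prop)]
  rw [h1, ← Measure.map_map hm (by fun_prop), Measure.infinitePi_map_restrict, h2,
    Measure.map_map hm (by fun_prop), stdComplexGaussian,
    Measure.map_map (ρ.sqrtEmbed s).continuous.measurable (by fun_prop)]
  congr 1
  ext x
  simp [ρ.sqrtEmbed_apply]

end

section

variable {H : Type*} [NormedAddCommGroup H] [InnerProductSpace ℂ H] [CompleteSpace H]

theorem DensityOperator.norm_adjoint_sqrtEmbed_le (ρ : DensityOperator H)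
    (s : Finset ρ.eigenIndex) : ‖ContinuousLinearMap.adjoint (ρ.sqrtEmbed s)‖ ≤ √‖ρ.op‖ := by
  rw [LinearIsometryEquiv.norm_map]
  exact ρ.norm_sqrtEmbed_le s

theorem DensityOperator.sqrtEmbed_single (ρ : DensityOperator H) (s : Finset ρ.eigenIndex)
    [DecidableEq s] (i : s) :
    ρ.sqrtEmbed s (EuclideanSpace.single i 1)
      = ((√(ρ.eigenvalue i : ℝ) : ℝ) : ℂ) • ρ.eigenbasis i := by
  rw [ρ.sqrtEmbed_apply, Finset.sum_eq_single i]
  · simp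
  · intro j _ hj
    simp [hj]
  · simp

/-- Exponential moment of a quadratic form in a truncated Gaussian vector. -/
theorem DensityOperator.lintegral_exp_sqrtEmbed_le (ρ : DensityOperator H)
    (s : Finset ρ.eigenIndex) (M : H →L[ℂ] H) (hM : IsSelfAdjoint M) (hn : ‖ρ.op‖ * ‖M‖ ≤ 1 / 2) :
    ∫⁻ x, ENNReal.ofReal (Real.exp (inner ℂ (ρ.sqrtEmbed s x) (M (ρ.sqrtEmbed s x))).re)
        ∂(stdComplexGaussian s)
      ≤ ENNReal.ofReal (Real.exp
          ((∑ i ∈ s, (ρ.eigenvalue i : ℂ) * inner ℂ (ρ.eigenbasis i) (M (ρ.eigenbasis i))).re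
            + ‖ρ.op‖ * ‖M‖ ^ 2)) := by
  classical
  set L := ρ.sqrtEmbed s with hL
  set r := ‖ρ.op‖ with hr
  have hr0 : 0 ≤ r := norm_nonneg _
  have hL1 : ‖L‖ ≤ √r := ρ.norm_sqrtEmbed_le s
  have hL2 : ‖ContinuousLinearMap.adjoint L‖ ≤ √r := ρ.norm_adjoint_sqrtEmbed_le s
  let T := ContinuousLinearMap.adjoint L ∘L M ∘L L
  have hT : IsSelfAdjoint T := hM.adjoint_conj L
  have hTn : ‖T‖ ≤ 1 / 2 := by
    calc ‖T‖ ≤ ‖ContinuousLinearMap.adjoint L‖ * (‖M‖ * ‖L‖) :=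
          (ContinuousLinearMap.opNorm_comp_le _ _).trans (by
            gcongr; exact ContinuousLinearMap.opNorm_comp_le _ _)
      _ ≤ √r * (‖M‖ * √r) := by gcongr
      _ = r * ‖M‖ := by rw [mul_comm ‖M‖, ← mul_assoc, Real.mul_self_sqrt hr0]
      _ ≤ 1 / 2 := hn
  have hTin : ∀ x, inner ℂ x (T x) = inner ℂ (L x) (M (L x)) := fun x => by
    simp [T, ContinuousLinearMap.adjoint_inner_right]
  have key := lintegral_exp_quadraticForm_le T hT.isSymmetric hTn
  simp only [hTin] at key
  refine key.trans (ENNReal.ofReal_le_ofReal (Real.exp_le_exp.2 (add_le_add (le_of_eq ?_) ?_)))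
  · rw [Complex.re_sum, ← Finset.sum_coe_sort s]
    refine Finset.sum_congr rfl fun i _ => ?_
    rw [ρ.sqrtEmbed_single, map_smul, inner_smul_left, inner_smul_right, ← mul_assoc,
      Complex.conj_ofReal, ← Complex.ofReal_mul, Real.mul_self_sqrt (NNReal.coe_nonneg _)]
  -- The Hilbert–Schmidt norm of T is bounded independently of the dimension: L sends the i-th unit
  -- vector to a vector of norm √(p i), and the p i sum to at most 1.
  · have h1 : ∀ i : s, ‖T (EuclideanSpace.single i (1 : ℂ))‖ ^ 2
        ≤ ρ.eigenvalue i * (r * ‖M‖ ^ 2) := by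
      intro i
      have h2 : ‖T (EuclideanSpace.single i (1 : ℂ))‖ ≤ √r * (‖M‖ * √(ρ.eigenvalue i : ℝ)) := by
        change ‖ContinuousLinearMap.adjoint L (M (L _))‖ ≤ _
        refine (ContinuousLinearMap.le_opNorm _ _).trans ?_
        gcongr
        refine (ContinuousLinearMap.le_opNorm _ _).trans ?_
        gcongr
        rw [ρ.sqrtEmbed_single, norm_smul, ρ.eigenbasis.orthonormal.1]
        simp [abs_of_nonneg]
      calc _ ≤ (√r * (‖M‖ * √(ρ.eigenvalue i : ℝ))) ^ 2 := by gcongr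
        _ = _ := by
          rw [mul_pow, mul_pow, Real.sq_sqrt hr0, Real.sq_sqrt (NNReal.coe_nonneg _)]; ring
    calc _ ≤ ∑ i : s, (ρ.eigenvalue i : ℝ) * (r * ‖M‖ ^ 2) := Finset.sum_le_sum fun i _ => h1 i
      _ = (∑ i ∈ s, (ρ.eigenvalue i : ℝ)) * (r * ‖M‖ ^ 2) := by
        rw [← Finset.sum_mul, Finset.sum_coe_sort s (fun i => (ρ.eigenvalue i : ℝ))]
      _ ≤ 1 * (r * ‖M‖ ^ 2) := by
        gcongr
        exact sum_le_hasSum s (fun _ _ => NNReal.coe_nonneg _) ρ.hasSum_eigenvalue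
      _ = r * ‖M‖ ^ 2 := one_mul _

/-! ### The infinite-dimensional Gaussian measure and its moments -/

variable [TopologicalSpace.SeparableSpace H]

theorem DensityOperator.countable_eigenIndex (ρ : DensityOperator H) : Countable ρ.eigenIndex :=
  ρ.eigenbasis.countable_of_separable

theorem DensityOperator.lintegral_tsum_normSq (ρ : DensityOperator H) :
    ∫⁻ z, ∑' i, ENNReal.ofReal (‖z i‖ ^ 2)
      ∂(Measure.infinitePi fun n => complexGaussian (ρ.eigenvalue n)) = 1 := by
  have := ρ.countable_eigenIndex
  rw [lintegral_tsum fun i => Measurable.aemeasurable (by fun_prop)]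
  have h : ∀ i, ∫⁻ z, ENNReal.ofReal (‖z i‖ ^ 2)
      ∂(Measure.infinitePi fun n => complexGaussian (ρ.eigenvalue n)) = ρ.eigenvalue i := by
    intro i
    rw [← lintegral_normSq_complexGaussian,
      ← (measurePreserving_eval_infinitePi (fun n => complexGaussian (ρ.eigenvalue n)) i).map_eq,
      lintegral_map (by fun_prop) (by fun_prop)]
  simp only [h]
  have h1 : HasSum ρ.eigenvalue 1 := NNReal.hasSum_coe.1 (by simpa using ρ.hasSum_eigenvalue)
  rw [← ENNReal.coe_tsum h1.summable, h1.tsum_eq, ENNReal.coe_one]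

/-- Since E ∑ |Z n|² = ∑ p n = 1, the coefficients are almost surely in ℓ². The Hilbert basis then
gives convergence and Parseval's identity. -/
theorem DensityOperator.ae_hasSum_and_norm (ρ : DensityOperator H) :
    ∀ᵐ z ∂(Measure.infinitePi fun n => complexGaussian (ρ.eigenvalue n)),
      HasSum (fun n => z n • ρ.eigenbasis n) (∑' n, z n • ρ.eigenbasis n) ∧
      ENNReal.ofReal (‖∑' n, z n • ρ.eigenbasis n‖ ^ 2) = ∑' n, ENNReal.ofReal (‖z n‖ ^ 2) := by
  have := ρ.countable_eigenIndex
  have h := ae_lt_top (by fun_prop) (ρ.lintegral_tsum_normSq.trans_ne ENNReal.one_ne_top)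
  filter_upwards [h] with z hz
  have hs : Summable fun i => ‖z i‖ ^ 2 := by
    have := ENNReal.summable_toReal hz.ne
    refine this.congr fun i => ?_
    rw [ENNReal.toReal_ofReal (by positivity)]
  have hmem : Memℓp z 2 := memℓp_gen (by simpa using hs)
  have h1 := ρ.eigenbasis.hasSum_repr_symm ⟨z, hmem⟩
  have h2 : HasSum (fun n => z n • ρ.eigenbasis n) (ρ.eigenbasis.repr.symm ⟨z, hmem⟩) := h1
  rw [h2.tsum_eq]
  refine ⟨h2, ?_⟩
  rw [LinearIsometryEquiv.norm_map, ← ENNReal.ofReal_tsum_of_nonneg (fun _ => by positivity) hs]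
  have h3 := lp.norm_rpow_eq_tsum (p := 2) (by norm_num) (⟨z, hmem⟩ : lp (fun _ => ℂ) 2)
  congr 1
  simpa using h3

theorem DensityOperator.ae_tendsto_truncation (ρ : DensityOperator H) :
    ∀ᵐ z ∂(Measure.infinitePi fun n => complexGaussian (ρ.eigenvalue n)),
      Filter.Tendsto (fun s : Finset ρ.eigenIndex => ∑ i ∈ s, z i • ρ.eigenbasis i) Filter.atTop
        (nhds (∑' n, z n • ρ.eigenbasis n)) :=
  ρ.ae_hasSum_and_norm.mono fun _ hz => by
    simpa [HasSum, SummationFilter.unconditional_filter] using hz.1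

variable [MeasurableSpace H] [BorelSpace H]

/-- Without this, `Measure.map` in the definition of G(ρ) would take its default value 0. -/
theorem DensityOperator.aemeasurable_tsum (ρ : DensityOperator H) :
    AEMeasurable (fun z : ρ.eigenIndex → ℂ => ∑' n, z n • ρ.eigenbasis n)
      (Measure.infinitePi fun n => complexGaussian (ρ.eigenvalue n)) := by
  have := ρ.countable_eigenIndex
  exact aemeasurable_of_tendsto_metrizable_ae Filter.atTop
    (fun s => (ρ.measurable_truncation s).aemeasurable) ρ.ae_tendsto_truncation

theorem lintegral_normSq_gaussianG (ρ : DensityOperator H) :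
    ∫⁻ ψ, ENNReal.ofReal (‖ψ‖ ^ 2) ∂(gaussianG ρ) = 1 := by
  rw [gaussianG, lintegral_map' (by fun_prop) ρ.aemeasurable_tsum, ← ρ.lintegral_tsum_normSq]
  exact lintegral_congr_ae (ρ.ae_hasSum_and_norm.mono fun z hz => hz.2)

/-- Exponential moment of a bounded quadratic form under `G(ρ)`. -/
theorem lintegral_exp_quadraticForm_gaussianG_le (ρ : DensityOperator H) (M : H →L[ℂ] H)
    (hM : IsSelfAdjoint M) (hn : ‖ρ.op‖ * ‖M‖ ≤ 1 / 2) :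
    ∫⁻ ψ, ENNReal.ofReal (Real.exp (inner ℂ ψ (M ψ)).re) ∂(gaussianG ρ)
      ≤ ENNReal.ofReal (Real.exp ((ρ.expect M).re + ‖ρ.op‖ * ‖M‖ ^ 2)) := by
  have := ρ.countable_eigenIndex
  have hc : Continuous fun ψ : H => ENNReal.ofReal (Real.exp (inner ℂ ψ (M ψ)).re) :=
    ENNReal.continuous_ofReal.comp (Real.continuous_exp.comp (Complex.continuous_re.comp
      (continuous_id.inner M.continuous)))
  rw [gaussianG, lintegral_map' hc.measurable.aemeasurable ρ.aemeasurable_tsum]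
  set μ := Measure.infinitePi fun n => complexGaussian (ρ.eigenvalue n) with hμ
  -- Fatou's lemma along finite truncations: it needs no dominating function for the unbounded
  -- integrand, and only an upper bound is wanted.
  calc _ = ∫⁻ z, Filter.liminf (fun s : Finset ρ.eigenIndex =>
          (fun ψ : H => ENNReal.ofReal (Real.exp (inner ℂ ψ (M ψ)).re))
            (∑ i ∈ s, z i • ρ.eigenbasis i)) Filter.atTop ∂μ :=
        lintegral_congr_ae (ρ.ae_tendsto_truncation.mono fun z hz =>
          ((hc.tendsto _).comp hz).liminf_eq.symm)
    _ ≤ Filter.liminf (fun s : Finset ρ.eigenIndex => ∫⁻ z,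
          (fun ψ : H => ENNReal.ofReal (Real.exp (inner ℂ ψ (M ψ)).re))
            (∑ i ∈ s, z i • ρ.eigenbasis i) ∂μ) Filter.atTop :=
        lintegral_liminf_le fun s => hc.measurable.comp (ρ.measurable_truncation s)
    _ ≤ Filter.liminf (fun s : Finset ρ.eigenIndex => ENNReal.ofReal (Real.exp
          ((∑ i ∈ s, (ρ.eigenvalue i : ℂ) * inner ℂ (ρ.eigenbasis i) (M (ρ.eigenbasis i))).re
            + ‖ρ.op‖ * ‖M‖ ^ 2))) Filter.atTop := by
        refine Filter.liminf_le_liminf (.of_forall fun s => ?_)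
        rw [← lintegral_map hc.measurable (ρ.measurable_truncation s), hμ, ρ.map_truncation,
          lintegral_map hc.measurable (ρ.sqrtEmbed s).continuous.measurable]
        exact ρ.lintegral_exp_sqrtEmbed_le s M hM hn
    _ = _ := by
        refine Filter.Tendsto.liminf_eq ?_
        have h : Filter.Tendsto (fun s : Finset ρ.eigenIndex => ∑ i ∈ s,
          (ρ.eigenvalue i : ℂ) * inner ℂ (ρ.eigenbasis i) (M (ρ.eigenbasis i))) Filter.atTop
            (nhds (ρ.expect M)) := by
          simpa [HasSum, SummationFilter.unconditional_filter] using ρ.hasSum_expect M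
        exact (ENNReal.continuous_ofReal.tendsto _).comp ((Real.continuous_exp.tendsto _).comp
          (((Complex.continuous_re.tendsto _).comp h).add_const _))

/-- An inequality suffices for tail bounds. It comes from dropping the restriction to the sphere, so
the exceptional point ψ = 0 needs no discussion. -/
theorem lintegral_GAP_le (ρ : DensityOperator H) {f : H → ℝ≥0∞} (hf : Measurable f) :
    ∫⁻ ψ, f ψ ∂(GAP ρ)
      ≤ ∫⁻ ψ, ENNReal.ofReal (‖ψ‖ ^ 2) * f (((‖ψ‖⁻¹ : ℝ) : ℂ) • ψ) ∂(gaussianG ρ) := by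
  have hm : Measurable fun ψ : H => ((‖ψ‖⁻¹ : ℝ) : ℂ) • ψ := by fun_prop
  rw [GAP, lintegral_subtype_comap Metric.isClosed_sphere.measurableSet]
  refine (setLIntegral_le_lintegral _ _).trans ?_
  rw [lintegral_map hf hm, gaussianGA]
  exact (lintegral_withDensity_eq_lintegral_mul _ (by fun_prop) (hf.comp hm)).le

theorem GAP_univ_le (ρ : DensityOperator H) : GAP ρ Set.univ ≤ 1 := by
  have h := lintegral_GAP_le ρ (f := fun _ => 1) measurable_const
  simpa only [lintegral_const, one_mul, mul_one, lintegral_normSq_gaussianG] using h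

end

/-! ### Concentration of quadratic forms under GAP(ρ) -/

section

variable {H : Type*} [NormedAddCommGroup H] [InnerProductSpace ℂ H] [CompleteSpace H]
  [TopologicalSpace.SeparableSpace H] [MeasurableSpace H] [BorelSpace H]

/-- One-sided large deviation bound for the real part of `⟨ψ, C ψ⟩`. -/
theorem GAP_re_inner_tail (ρ : DensityOperator H) (C : H →L[ℂ] H) {b δ : ℝ} (hb : 0 < b)
    (hC : ‖C‖ ≤ b) (hδ : 0 ≤ δ) (hδb : δ ≤ 2 * b) (hr : ‖ρ.op‖ ≤ 1 / 1000) :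
    GAP ρ {ψ | (ρ.expect C).re + δ < (inner ℂ (ψ : H) (C ψ)).re}
      ≤ ENNReal.ofReal (Real.exp (-(δ ^ 2 / (128 * ‖ρ.op‖ * b ^ 2)) + 2 * ‖ρ.op‖)) := by
  set r := ‖ρ.op‖ with hrdef
  have hr0 : 0 < r := ρ.norm_op_pos
  set m := (ρ.expect C).re + δ with hm
  -- The minimizer of -sδ + 32 r b² s², with minimum -δ²/(128 r b²). This is the exponent left by
  -- ‖M‖² ≤ 2(4bs)² + 2, up to the term 2r.
  set s := δ / (64 * r * b ^ 2) with hs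
  have hs0 : 0 ≤ s := by positivity
  -- The form of M is s(Re⟨ψ, Cψ⟩ - m‖ψ‖²) + ‖ψ‖²: the Chernoff exponent plus the identity that
  -- absorbs the density. Its expectation is 1 - sδ, and the 1 cancels against the factor e⁻¹.
  let M : H →L[ℂ] H := ((s / 2 : ℝ) : ℂ) • (C + ContinuousLinearMap.adjoint C)
    + ((1 - s * m : ℝ) : ℂ) • 1
  have hMsa : IsSelfAdjoint M := by
    refine IsSelfAdjoint.add (IsSelfAdjoint.smul (Complex.conj_ofReal _) ?_)
      (IsSelfAdjoint.smul (Complex.conj_ofReal _) (IsSelfAdjoint.one _))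
    exact IsSelfAdjoint.add_star_self C
  have hMin : ∀ ψ : H, (inner ℂ ψ (M ψ)).re
      = s * ((inner ℂ ψ (C ψ)).re - m * ‖ψ‖ ^ 2) + ‖ψ‖ ^ 2 := by
    intro ψ
    have h1 : (inner ℂ ψ (ContinuousLinearMap.adjoint C ψ)).re = (inner ℂ ψ (C ψ)).re := by
      rw [ContinuousLinearMap.adjoint_inner_right, ← inner_conj_symm, Complex.conj_re]
    have h2 : (inner ℂ ψ ψ).re = ‖ψ‖ ^ 2 := inner_self_eq_norm_sq (𝕜 := ℂ) ψ
    simp only [M, add_apply, smul_apply, one_apply_eq_self, inner_add_right, inner_smul_right,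
      Complex.add_re, Complex.re_ofReal_mul, h1, h2]
    ring
  have hMex : (ρ.expect M).re = 1 - s * δ := by
    simp only [M, ρ.expect_add, ρ.expect_smul, ρ.expect_one, ρ.expect_adjoint, Complex.add_re,
      Complex.re_ofReal_mul, Complex.conj_re, Complex.one_re, hm]
    ring
  have hτ : |(ρ.expect C).re| ≤ b :=
    (Complex.abs_re_le_norm _).trans ((ρ.norm_expect_le C).trans hC)
  have hmb : |m| ≤ 3 * b := by
    rw [abs_le] at hτ ⊢
    constructor <;> linarith [hτ.1, hτ.2]
  have hMn : ‖M‖ ≤ 4 * b * s + 1 := by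
    have h1 : ‖C + ContinuousLinearMap.adjoint C‖ ≤ 2 * b := by
      refine (norm_add_le _ _).trans ?_
      rw [LinearIsometryEquiv.norm_map]; linarith
    have h2 : |1 - s * m| ≤ 1 + s * (3 * b) := by
      refine (abs_sub _ _).trans ?_
      rw [abs_one, abs_mul, abs_of_nonneg hs0]
      gcongr
    calc ‖M‖ ≤ s / 2 * (2 * b) + (1 + s * (3 * b)) * 1 := by
          refine (norm_add_le _ _).trans ?_
          rw [norm_smul, norm_smul, Complex.norm_real, Complex.norm_real, Real.norm_eq_abs,
            Real.norm_eq_abs, abs_of_nonneg (by positivity : 0 ≤ s / 2)]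
          gcongr
          exact ContinuousLinearMap.norm_id_le
      _ = _ := by ring
  have hrs : r * (4 * b * s) = δ / (16 * b) := by
    rw [hs]; field_simp; ring
  have hrM : r * ‖M‖ ≤ 1 / 2 := by
    have h1 : r * (4 * b * s) ≤ 1 / 8 := by
      rw [hrs, div_le_iff₀ (by positivity)]; linarith
    calc r * ‖M‖ ≤ r * (4 * b * s + 1) := by gcongr
      _ ≤ 1 / 2 := by linarith
  have hexp : -1 + (1 - s * δ + r * ‖M‖ ^ 2) ≤ -(δ ^ 2 / (128 * r * b ^ 2)) + 2 * r := by
    have h1 : r * ‖M‖ ^ 2 ≤ r * (2 * (4 * b * s) ^ 2 + 2) := by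
      gcongr
      calc ‖M‖ ^ 2 ≤ (4 * b * s + 1) ^ 2 := by gcongr
        _ ≤ _ := by nlinarith [sq_nonneg (4 * b * s - 1)]
    have h2 : -(s * δ) + r * (2 * (4 * b * s) ^ 2) = -(δ ^ 2 / (128 * r * b ^ 2)) := by
      rw [hs]; field_simp; ring
    linarith
  have hSm : MeasurableSet {ψ : H | m < (inner ℂ ψ (C ψ)).re} :=
    measurableSet_lt measurable_const (Complex.continuous_re.comp
      (continuous_id.inner C.continuous)).measurable
  set S := {ψ : H | m < (inner ℂ ψ (C ψ)).re} with hS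
  have hpt : ∀ ψ : H, ENNReal.ofReal (‖ψ‖ ^ 2) * S.indicator 1 (((‖ψ‖⁻¹ : ℝ) : ℂ) • ψ)
      ≤ ENNReal.ofReal (Real.exp (-1)) * ENNReal.ofReal (Real.exp (inner ℂ ψ (M ψ)).re) := by
    intro ψ
    by_cases hψ : ((‖ψ‖⁻¹ : ℝ) : ℂ) • ψ ∈ S
    -- At ψ = 0 the normalization is a default value, but the weight ‖ψ‖² vanishes.
    · rcases eq_or_ne ψ 0 with rfl | h0
      · simp
      rw [Set.indicator_of_mem hψ, Pi.one_apply, mul_one,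
        ← ENNReal.ofReal_mul (Real.exp_pos _).le, ← Real.exp_add]
      refine ENNReal.ofReal_le_ofReal ?_
      have hn : 0 < ‖ψ‖ := norm_pos_iff.2 h0
      have h1 : m * ‖ψ‖ ^ 2 ≤ (inner ℂ ψ (C ψ)).re := by
        rw [hS, Set.mem_ofPred_eq, map_smul, inner_smul_left, inner_smul_right, Complex.conj_ofReal,
          Complex.re_ofReal_mul, Complex.re_ofReal_mul] at hψ
        have h2 := mul_le_mul_of_nonneg_right hψ.le (sq_nonneg ‖ψ‖)
        refine h2.trans (le_of_eq ?_)
        field_simp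
      have h2 : 0 ≤ s * ((inner ℂ ψ (C ψ)).re - m * ‖ψ‖ ^ 2) := mul_nonneg hs0 (by linarith)
      calc ‖ψ‖ ^ 2 ≤ Real.exp (‖ψ‖ ^ 2 - 1) := by linarith [Real.add_one_le_exp (‖ψ‖ ^ 2 - 1)]
        _ ≤ _ := Real.exp_le_exp.2 (by rw [hMin]; linarith)
    · rw [Set.indicator_of_notMem hψ]; simp
  have hcon : Continuous fun ψ : H => ENNReal.ofReal (Real.exp (inner ℂ ψ (M ψ)).re) :=
    ENNReal.continuous_ofReal.comp (Real.continuous_exp.comp (Complex.continuous_re.comp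
      (continuous_id.inner M.continuous)))
  calc GAP ρ {ψ | m < (inner ℂ (ψ : H) (C ψ)).re}
      = ∫⁻ ψ, S.indicator 1 (ψ : H) ∂(GAP ρ) := by
        exact (lintegral_indicator_one (measurable_subtype_coe hSm)).symm
    _ ≤ _ := lintegral_GAP_le ρ (measurable_one.indicator hSm)
    _ ≤ _ := lintegral_mono hpt
    _ = ENNReal.ofReal (Real.exp (-1))
        * ∫⁻ ψ, ENNReal.ofReal (Real.exp (inner ℂ ψ (M ψ)).re) ∂(gaussianG ρ) :=
        lintegral_const_mul _ hcon.measurable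
    _ ≤ ENNReal.ofReal (Real.exp (-1)) * ENNReal.ofReal (Real.exp (1 - s * δ + r * ‖M‖ ^ 2)) := by
        gcongr
        rw [← hMex]
        exact lintegral_exp_quadraticForm_gaussianG_le ρ M hMsa hrM
    _ ≤ _ := by
        rw [← ENNReal.ofReal_mul (Real.exp_pos _).le, ← Real.exp_add]
        exact ENNReal.ofReal_le_ofReal (Real.exp_le_exp.2 hexp)

/-- Large deviation bound for `⟨ψ, B ψ⟩`. -/
theorem GAP_inner_tail (ρ : DensityOperator H) (B : H →L[ℂ] H) {b ε : ℝ} (hb : 0 < b)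
    (hB : ‖B‖ ≤ b) (hε : 0 ≤ ε) (hr : ‖ρ.op‖ ≤ 1 / 1000) :
    GAP ρ {ψ | ε < ‖inner ℂ (ψ : H) (B ψ) - ρ.expect B‖}
      ≤ ENNReal.ofReal (5 * Real.exp (-(ε ^ 2 / (512 * ‖ρ.op‖ * b ^ 2)))) := by
  -- The deviation never exceeds 2b, so large ε gives an empty event. Otherwise δ = ε/2 satisfies
  -- the restriction δ ≤ 2b of the one-sided bound.
  rcases lt_or_ge (4 * b) ε with hεb | hεb
  · have : {ψ : Metric.sphere (0 : H) 1 | ε < ‖inner ℂ (ψ : H) (B ψ) - ρ.expect B‖} = ∅ := by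
      refine Set.eq_empty_of_forall_notMem fun ψ hψ => ?_
      have := ρ.norm_inner_sub_expect_le B ψ
      rw [Set.mem_ofPred_eq] at hψ
      linarith
    rw [this, measure_empty]
    exact zero_le
  -- As |z| ≤ |Re z| + |Im z|, a deviation above ε forces Re(uz) > ε/2 for some u among ±1, ±i. Each
  -- of the four events costs 5/4, since exp(2‖ρ‖) ≤ 5/4.
  let E (u : ℂ) : Set (Metric.sphere (0 : H) 1) :=
    {ψ | (ρ.expect (u • B)).re + ε / 2 < (inner ℂ (ψ : H) ((u • B) ψ)).re}
  have hE : ∀ u : ℂ, ‖u‖ = 1 → GAP ρ (E u) ≤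
      ENNReal.ofReal (Real.exp (-((ε / 2) ^ 2 / (128 * ‖ρ.op‖ * b ^ 2)) + 2 * ‖ρ.op‖)) :=
    fun u hu => GAP_re_inner_tail ρ (u • B) hb (by rw [norm_smul, hu, one_mul]; exact hB)
      (by linarith) (by linarith) hr
  have hsub : {ψ : Metric.sphere (0 : H) 1 | ε < ‖inner ℂ (ψ : H) (B ψ) - ρ.expect B‖}
      ⊆ (E 1 ∪ E (-1)) ∪ (E Complex.I ∪ E (-Complex.I)) := by
    intro ψ hψ
    rw [Set.mem_ofPred_eq] at hψ
    by_contra hc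
    simp only [E, Set.mem_union, Set.mem_ofPred_eq, not_or, not_lt, ρ.expect_smul, smul_apply,
      inner_smul_right, neg_mul, one_mul, Complex.neg_re, Complex.I_mul_re] at hc
    obtain ⟨⟨h1, h2⟩, h3, h4⟩ := hc
    have h5 := Complex.norm_le_abs_re_add_abs_im (inner ℂ (ψ : H) (B ψ) - ρ.expect B)
    have h6 : |(inner ℂ (ψ : H) (B ψ) - ρ.expect B).re| ≤ ε / 2 := by
      rw [Complex.sub_re, abs_le]; constructor <;> linarith
    have h7 : |(inner ℂ (ψ : H) (B ψ) - ρ.expect B).im| ≤ ε / 2 := by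
      rw [Complex.sub_im, abs_le]; constructor <;> linarith
    linarith
  have hfin : Real.exp (-((ε / 2) ^ 2 / (128 * ‖ρ.op‖ * b ^ 2)) + 2 * ‖ρ.op‖)
      ≤ 5 / 4 * Real.exp (-(ε ^ 2 / (512 * ‖ρ.op‖ * b ^ 2))) := by
    rw [Real.exp_add, mul_comm]
    have h1 : (ε / 2) ^ 2 / (128 * ‖ρ.op‖ * b ^ 2) = ε ^ 2 / (512 * ‖ρ.op‖ * b ^ 2) := by
      have := ρ.norm_op_pos
      field_simp; ring
    rw [h1]
    gcongr
    have h2 : Real.exp (2 * ‖ρ.op‖) ≤ 1 / (1 - 2 * ‖ρ.op‖) :=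
      Real.exp_bound_div_one_sub_of_interval (by positivity) (by linarith)
    refine h2.trans ?_
    rw [div_le_iff₀ (by linarith)]
    linarith
  calc _ ≤ _ := measure_mono hsub
    _ ≤ (GAP ρ (E 1) + GAP ρ (E (-1))) + (GAP ρ (E Complex.I) + GAP ρ (E (-Complex.I))) :=
      (measure_union_le _ _).trans (add_le_add (measure_union_le _ _) (measure_union_le _ _))
    _ ≤ (ENNReal.ofReal (5 / 4 * Real.exp (-(ε ^ 2 / (512 * ‖ρ.op‖ * b ^ 2))))
          + ENNReal.ofReal (5 / 4 * Real.exp (-(ε ^ 2 / (512 * ‖ρ.op‖ * b ^ 2)))))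
        + (ENNReal.ofReal (5 / 4 * Real.exp (-(ε ^ 2 / (512 * ‖ρ.op‖ * b ^ 2))))
          + ENNReal.ofReal (5 / 4 * Real.exp (-(ε ^ 2 / (512 * ‖ρ.op‖ * b ^ 2))))) := by
      gcongr <;> exact (hE _ (by simp)).trans (ENNReal.ofReal_le_ofReal hfin)
    _ = _ := by
      rw [← ENNReal.ofReal_add (by positivity) (by positivity),
        ← ENNReal.ofReal_add (by positivity) (by positivity)]
      congr 1; ring

/-- Gaussian concentration of `⟨ψ, B ψ⟩` in the form of a square-exponential moment. -/
theorem lintegral_exp_sq_GAP_le (ρ : DensityOperator H) (B : H →L[ℂ] H) {b : ℝ} (hb : 0 < b)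
    (hB : ‖B‖ ≤ b) :
    ∫⁻ ψ : Metric.sphere (0 : H) 1, ENNReal.ofReal (Real.exp
        (1 / (2304 * Real.pi ^ 2) / (b ^ 2 * ‖ρ.op‖)
          * ‖inner ℂ (ψ : H) (B ψ) - ρ.expect B‖ ^ 2)) ∂(GAP ρ) ≤ 9 := by
  have hr0 : 0 < ‖ρ.op‖ := ρ.norm_op_pos
  have hpi : (9 : ℝ) ≤ Real.pi ^ 2 := by nlinarith [Real.pi_gt_three]
  have hconst : 1 / (2304 * Real.pi ^ 2) ≤ (1 / 20000 : ℝ) := by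
    gcongr; linarith
  set a := 1 / (2304 * Real.pi ^ 2) / (b ^ 2 * ‖ρ.op‖) with ha
  have ha0 : 0 < a := by positivity
  set X := fun ψ : Metric.sphere (0 : H) 1 => ‖inner ℂ (ψ : H) (B ψ) - ρ.expect B‖ with hX
  have hXm : Measurable X := by
    refine Continuous.measurable ?_
    exact ((continuous_subtype_val.inner (B.continuous.comp continuous_subtype_val)).sub
      continuous_const).norm
  -- When ‖ρ‖ is not small, X ≤ 2b alone gives aX² ≤ 1, and e < 9.
  rcases lt_or_ge (1 / 1000) ‖ρ.op‖ with hr | hr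
  · have h1 : ∀ ψ, Real.exp (a * X ψ ^ 2) ≤ 9 := by
      intro ψ
      have h2 : X ψ ≤ 2 * b := (ρ.norm_inner_sub_expect_le B ψ).trans (by linarith)
      have h3 : a * X ψ ^ 2 ≤ 1 := by
        calc a * X ψ ^ 2 ≤ a * (2 * b) ^ 2 := by gcongr
          _ = 4 * (1 / (2304 * Real.pi ^ 2)) / ‖ρ.op‖ := by rw [ha]; field_simp; ring
          _ ≤ 1 := by rw [div_le_one hr0]; linarith
      linarith [Real.exp_le_exp.2 h3, Real.exp_one_lt_d9]
    calc _ ≤ ∫⁻ _, 9 ∂(GAP ρ) := lintegral_mono fun ψ => by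
          rw [ENNReal.ofReal_le_iff_le_toReal (by norm_num)]
          exact h1 ψ
      _ ≤ 9 := by
        rw [lintegral_const]
        exact mul_le_of_le_one_right zero_le (GAP_univ_le ρ)
  -- Layer cake: levels t ≤ 1 contribute at most 1. For t > 1 the tail is at most 5 t^(-2304π²/512)
  -- ≤ 5 t⁻², whose integral is 5. The total 6 is below 9.
  · rw [lintegral_eq_lintegral_meas_lt _ (.of_forall fun _ => (Real.exp_pos _).le)
      (by fun_prop), ← Set.Ioc_union_Ioi_eq_Ioi zero_le_one]
    refine (lintegral_union_le _ _ _).trans ?_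
    have h1 : ∫⁻ t in Set.Ioc (0 : ℝ) 1, GAP ρ {ψ | t < Real.exp (a * X ψ ^ 2)} ≤ 1 := by
      calc _ ≤ ∫⁻ _ in Set.Ioc (0 : ℝ) 1, 1 :=
            lintegral_mono fun t => (measure_mono (Set.subset_univ _)).trans (GAP_univ_le ρ)
        _ = 1 := by simp
    have h2 : ∫⁻ t in Set.Ioi (1 : ℝ), GAP ρ {ψ | t < Real.exp (a * X ψ ^ 2)} ≤ 5 := by
      calc _ ≤ ∫⁻ t in Set.Ioi (1 : ℝ), ENNReal.ofReal (5 * t ^ (-2 : ℝ)) := by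
            refine setLIntegral_mono (by fun_prop) fun t ht => ?_
            have ht1 : (1 : ℝ) < t := ht
            have hlog : 0 < Real.log t := Real.log_pos ht1
            refine le_trans (measure_mono (t := {ψ | √(Real.log t / a) < X ψ}) fun ψ hψ => ?_)
              ((GAP_inner_tail ρ B hb hB (Real.sqrt_nonneg _) hr).trans
                (ENNReal.ofReal_le_ofReal ?_))
            · have h3 : Real.log t < a * X ψ ^ 2 := (Real.log_lt_iff_lt_exp (by linarith)).2 hψ
              refine (Real.sqrt_lt_sqrt (by positivity) ((div_lt_iff₀' ha0).2 h3)).trans_eq ?_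
              exact Real.sqrt_sq (norm_nonneg _)
            · rw [Real.sq_sqrt (by positivity), Real.rpow_def_of_pos (by linarith)]
              gcongr
              have h4 : Real.log t / a / (512 * ‖ρ.op‖ * b ^ 2)
                  = Real.log t * (2304 * Real.pi ^ 2 / 512) := by
                rw [ha]; field_simp
              rw [h4]
              nlinarith
        _ = 5 := by
            rw [← ofReal_integral_eq_lintegral_ofReal, integral_const_mul,
              integral_Ioi_rpow_of_lt (by norm_num) (by norm_num)]
            · norm_num
            · exact ((integrableOn_Ioi_rpow_of_lt (by norm_num) (by norm_num)).const_mul 5)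
            · filter_upwards [ae_restrict_mem measurableSet_Ioi] with t ht
              have : (0 : ℝ) < t := lt_trans one_pos ht
              positivity
    calc _ ≤ (1 : ℝ≥0∞) + 5 := add_le_add h1 h2
      _ ≤ 9 := by norm_num

end

/-! ### Cyclicity of the trace and unitary conjugation -/

theorem HilbertBasis.hasSum_apply_of_eigen {ι H : Type*} [NormedAddCommGroup H]
    [InnerProductSpace ℂ H] (e : HilbertBasis ι ℂ H) (A : H →L[ℂ] H) (p : ι → ℂ)
    (hp : ∀ i, A (e i) = p i • e i) (x y : H) :
    HasSum (fun i => p i * (inner ℂ x (e i) * inner ℂ (e i) y)) (inner ℂ x (A y)) := by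
  have h := ((e.hasSum_repr y).mapL A).mapL (innerSL ℂ x)
  have h1 : ∀ i, innerSL ℂ x (A (e.repr y i • e i)) = p i * (inner ℂ x (e i) * inner ℂ (e i) y) := by
    intro i
    rw [map_smul, hp, innerSL_apply_apply, inner_smul_right, inner_smul_right, e.repr_apply_apply]
    ring
  simp only [h1] at h
  exact h

/-- Interchange of an orthonormal expansion with a summable family of weights. -/
theorem HilbertBasis.hasSum_swap {ι κ H : Type*} [NormedAddCommGroup H]
    [InnerProductSpace ℂ H] (e : HilbertBasis κ ℂ H) {p : ι → ℝ} (hp : Summable p)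
    (hp0 : ∀ k, 0 ≤ p k) {x y : ι → H} {c d : ℝ} (hx : ∀ k, ‖x k‖ ≤ c) (hy : ∀ k, ‖y k‖ ≤ d)
    {τ : ℂ} (hτ : HasSum (fun k => (p k : ℂ) * inner ℂ (x k) (y k)) τ) {f : κ → ℂ}
    (hf : ∀ i, HasSum (fun k => (p k : ℂ) * (inner ℂ (x k) (e i) * inner ℂ (e i) (y k))) (f i)) :
    HasSum f τ := by
  let F : ι × κ → ℂ := fun q =>
    (p q.1 : ℂ) * (inner ℂ (x q.1) (e q.2) * inner ℂ (e q.2) (y q.1))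
  -- A summable majorant of the double series: |uv| ≤ |u|² + |v|², and Bessel's inequality bounds
  -- each row by p k (c² + d²).
  let G : ι × κ → ℝ := fun q =>
    p q.1 * (‖inner ℂ (e q.2) (x q.1)‖ ^ 2 + ‖inner ℂ (e q.2) (y q.1)‖ ^ 2)
  have hG0 : ∀ q, 0 ≤ G q := fun q => mul_nonneg (hp0 _) (by positivity)
  have hsq : ∀ z : H, Summable fun i => ‖inner ℂ (e i) z‖ ^ 2 := fun z =>
    e.orthonormal.inner_products_summable (x := z)
  have hbessel : ∀ z : H, ∑' i, ‖inner ℂ (e i) z‖ ^ 2 ≤ ‖z‖ ^ 2 := fun z =>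
    e.orthonormal.tsum_inner_products_le (x := z)
  have hrow : ∀ k, HasSum (fun i => G (k, i)) (p k *
      (∑' i, ‖inner ℂ (e i) (x k)‖ ^ 2 + ∑' i, ‖inner ℂ (e i) (y k)‖ ^ 2)) := fun k =>
    ((hsq (x k)).hasSum.add (hsq (y k)).hasSum).mul_left (p k)
  have hG : Summable G := by
    refine (summable_prod_of_nonneg hG0).2 ⟨fun k => (hrow k).summable, ?_⟩
    refine Summable.of_nonneg_of_le (fun k => tsum_nonneg fun i => hG0 _) (fun k => ?_)
      (hp.mul_right (c ^ 2 + d ^ 2))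
    rw [(hrow k).tsum_eq]
    refine mul_le_mul_of_nonneg_left (add_le_add ?_ ?_) (hp0 k)
    · exact (hbessel _).trans (pow_le_pow_left₀ (norm_nonneg _) (hx k) 2)
    · exact (hbessel _).trans (pow_le_pow_left₀ (norm_nonneg _) (hy k) 2)
  have hF : Summable F := by
    refine Summable.of_norm_bounded hG fun q => ?_
    simp only [F, G]
    rw [norm_mul, norm_mul, norm_inner_symm (x q.1), Complex.norm_real, Real.norm_eq_abs,
      abs_of_nonneg (hp0 _)]
    refine mul_le_mul_of_nonneg_left ?_ (hp0 _)
    nlinarith [sq_nonneg (‖inner ℂ (e q.2) (x q.1)‖ - ‖inner ℂ (e q.2) (y q.1)‖),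
      sq_nonneg ‖inner ℂ (e q.2) (x q.1)‖, sq_nonneg ‖inner ℂ (e q.2) (y q.1)‖]
  have htot : HasSum F τ := by
    have h1 := hF.hasSum.prod_fiberwise fun k =>
      (e.hasSum_inner_mul_inner (x k) (y k)).mul_left (p k : ℂ)
    rw [hτ.unique h1]
    exact hF.hasSum
  have htot' : HasSum (fun q : κ × ι => F q.swap) τ := (Equiv.prodComm κ ι).hasSum_iff.2 htot
  exact htot'.prod_fiberwise hf

/-- Cyclicity of the trace for `V ρ V* B` with `V` unitary. -/
theorem DensityOperator.hasTrace_conj_mul {H : Type*} [NormedAddCommGroup H]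
    [InnerProductSpace ℂ H] [CompleteSpace H] (ρ : DensityOperator H)
    (V : unitary (H →L[ℂ] H)) (B : H →L[ℂ] H) :
    HasTrace (((V : H →L[ℂ] H) * ρ.op * star (V : H →L[ℂ] H)) * B)
      (ρ.expect (star (V : H →L[ℂ] H) * B * V)) := by
  intro w e
  generalize (V : H →L[ℂ] H) = W
  have hWn : ∀ k, ‖W (ρ.eigenbasis k)‖ ≤ ‖W‖ := fun k => by
    simpa [ρ.eigenbasis.orthonormal.1] using W.le_opNorm (ρ.eigenbasis k)
  -- Both traces are iterated sums of p k ⟨B*W e_k, e i⟩⟨e i, W e_k⟩, with e_k the eigenbasis of ρ: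
  -- summing over i first gives the expectation, and summing over k first gives the diagonal entries
  -- in the basis e.
  refine e.hasSum_swap ρ.hasSum_eigenvalue.summable (fun _ => NNReal.coe_nonneg _)
    (x := fun k => ContinuousLinearMap.adjoint B (W (ρ.eigenbasis k)))
    (y := fun k => W (ρ.eigenbasis k))
    (fun k => (ContinuousLinearMap.le_opNorm _ _).trans
      (mul_le_mul_of_nonneg_left (hWn k) (norm_nonneg _))) hWn ?_ fun i => ?_
  · have h := ρ.hasSum_expect (star W * B * W)
    simp only [mul_apply_eq_comp, ContinuousLinearMap.star_eq_adjoint,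
      ContinuousLinearMap.adjoint_inner_right] at h
    simpa only [ContinuousLinearMap.adjoint_inner_left,
      ContinuousLinearMap.star_eq_adjoint] using h
  · have h := ρ.eigenbasis.hasSum_apply_of_eigen ρ.op (fun k => ((ρ.eigenvalue k : ℝ) : ℂ))
      ρ.op_eigenbasis (ContinuousLinearMap.adjoint W (e i)) (ContinuousLinearMap.adjoint W (B (e i)))
    simp only [ContinuousLinearMap.adjoint_inner_left,
      ContinuousLinearMap.adjoint_inner_right] at h
    simp only [ContinuousLinearMap.adjoint_inner_left, mul_apply_eq_comp,
      ContinuousLinearMap.star_eq_adjoint]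
    simpa only [mul_comm (inner ℂ (W _) (B (e i)))] using h

theorem inner_apply_sub_opTrace {H : Type*} [NormedAddCommGroup H]
    [InnerProductSpace ℂ H] [CompleteSpace H] (ρ : DensityOperator H)
    (V : unitary (H →L[ℂ] H)) (B : H →L[ℂ] H) (ψ : H) :
    inner ℂ ((V : H →L[ℂ] H) ψ) (B ((V : H →L[ℂ] H) ψ))
        - opTrace (((V : H →L[ℂ] H) * ρ.op * star (V : H →L[ℂ] H)) * B)
      = inner ℂ ψ ((star (V : H →L[ℂ] H) * B * V) ψ)
        - ρ.expect (star (V : H →L[ℂ] H) * B * V) := by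
  rw [(ρ.hasTrace_conj_mul V B).opTrace_eq, mul_apply_eq_comp, mul_apply_eq_comp,
    ContinuousLinearMap.star_eq_adjoint, ContinuousLinearMap.adjoint_inner_right]

theorem norm_star_mul_mul_unitary {H : Type*} [NormedAddCommGroup H]
    [InnerProductSpace ℂ H] [CompleteSpace H] (V : unitary (H →L[ℂ] H)) (B : H →L[ℂ] H) :
    ‖star (V : H →L[ℂ] H) * B * V‖ = ‖B‖ := by
  rw [CStarRing.norm_mul_coe_unitary, ← Unitary.coe_star, CStarRing.norm_coe_unitary_mul]

/-! ### Markov and Jensen inequalities, and time averages -/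

theorem continuous_norm_inner_sub_expect {H : Type*} [NormedAddCommGroup H]
    [InnerProductSpace ℂ H] [CompleteSpace H] (ρ : DensityOperator H) (C : H →L[ℂ] H) :
    Continuous fun ψ : Metric.sphere (0 : H) 1 => ‖inner ℂ (ψ : H) (C ψ) - ρ.expect C‖ :=
  ((continuous_subtype_val.inner (C.continuous.comp continuous_subtype_val)).sub
    continuous_const).norm

/-- Chernoff bound from an exponential moment. -/
theorem measure_le_of_lintegral_le {α : Type*} [MeasurableSpace α] {μ : Measure α} {K c : ℝ}
    {g : α → ℝ≥0∞} (hg : Measurable g) (hK : ∫⁻ x, g x ∂μ ≤ ENNReal.ofReal K) {s : Set α}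
    (hs : ∀ x ∈ s, ENNReal.ofReal (Real.exp c) ≤ g x) :
    μ s ≤ ENNReal.ofReal (K * Real.exp (-c)) := by
  have h0 : ENNReal.ofReal (Real.exp c) ≠ 0 := by simp [Real.exp_pos]
  calc μ s ≤ μ {x | ENNReal.ofReal (Real.exp c) ≤ g x} := measure_mono hs
    _ ≤ (∫⁻ x, g x ∂μ) / ENNReal.ofReal (Real.exp c) :=
      meas_ge_le_lintegral_div hg.aemeasurable h0 ENNReal.ofReal_ne_top
    _ ≤ ENNReal.ofReal K / ENNReal.ofReal (Real.exp c) := by gcongr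
    _ = _ := by
      rw [← ENNReal.ofReal_div_of_pos (Real.exp_pos _), Real.exp_neg, div_eq_mul_inv]

theorem convexOn_exp_mul_sq {a : ℝ} (ha : 0 ≤ a) :
    ConvexOn ℝ Set.univ fun x : ℝ => Real.exp (a * x ^ 2) := by
  have h1 : ConvexOn ℝ Set.univ fun x : ℝ => a * x ^ 2 := by
    simpa using (even_two.convexOn_pow (𝕜 := ℝ)).smul ha
  exact (convexOn_exp.subset (Set.subset_univ _) (by
    have : Convex ℝ (Set.univ : Set ℝ) := convex_univ
    exact (h1.1.isPreconnected.image _ (by fun_prop)).ordConnected.convex)).comp h1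
    (Real.exp_monotone.monotoneOn _)

/-- Jensen's inequality for square-exponential moments of time averages. -/
theorem ofReal_exp_sq_average_le {a T b : ℝ} (ha : 0 ≤ a) (hT : 0 < T) {x : ℝ → ℝ}
    (hx : Measurable x) (hb : ∀ t, |x t| ≤ b) :
    ENNReal.ofReal (Real.exp (a * (1 / T * ∫ t in (0 : ℝ)..T, x t) ^ 2))
      ≤ ENNReal.ofReal (1 / T)
        * ∫⁻ t in Set.Ioc 0 T, ENNReal.ofReal (Real.exp (a * x t ^ 2)) := by
  have hfin : volume (Set.Ioc 0 T) ≠ ∞ := by simp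
  have h1 : IntegrableOn x (Set.Ioc 0 T) :=
    Measure.integrableOn_of_bounded hfin hx.aestronglyMeasurable (.of_forall hb)
  have h2 : IntegrableOn (fun t => Real.exp (a * x t ^ 2)) (Set.Ioc 0 T) := by
    refine Measure.integrableOn_of_bounded (M := Real.exp (a * b ^ 2)) hfin
      (Measurable.aestronglyMeasurable (by fun_prop)) (.of_forall fun t => ?_)
    rw [Real.norm_eq_abs, Real.abs_exp, Real.exp_le_exp, ← sq_abs (x t)]
    gcongr
    exact hb t
  have h3 := (convexOn_exp_mul_sq ha).map_set_average_le (μ := volume) (t := Set.Ioc 0 T)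
    (by fun_prop) isClosed_univ (by simpa using hT) hfin (by simp) h1 h2
  have hvol : volume.real (Set.Ioc 0 T) = T := by simp [Measure.real, hT.le]
  simp only [setAverage_eq, hvol, smul_eq_mul] at h3
  rw [intervalIntegral.integral_of_le hT.le, one_div]
  refine (ENNReal.ofReal_le_ofReal h3).trans (le_of_eq ?_)
  rw [ENNReal.ofReal_mul (by positivity),
    ofReal_integral_eq_lintegral_ofReal h2 (.of_forall fun _ => (Real.exp_pos _).le)]

section

variable {H : Type*} [NormedAddCommGroup H] [InnerProductSpace ℂ H] [CompleteSpace H]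
  [TopologicalSpace.SeparableSpace H] [MeasurableSpace H] [BorelSpace H]

/-- Each ⟨φ, U_t* B U_t φ⟩ is a continuous function of U_t φ, and the expectation is a pointwise
limit of finite combinations of such terms. -/
theorem measurable_inner_sub_expect (ρ : DensityOperator H) (B : H →L[ℂ] H)
    (U : ℝ → unitary (H →L[ℂ] H)) (hU : ∀ φ : H, Measurable fun t => (U t : H →L[ℂ] H) φ) (ψ : H) :
    Measurable fun t => inner ℂ ψ ((star (U t : H →L[ℂ] H) * B * (U t : H →L[ℂ] H)) ψ)
      - ρ.expect (star (U t : H →L[ℂ] H) * B * (U t : H →L[ℂ] H)) := by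
  have := ρ.countable_eigenIndex
  have h1 : ∀ φ : H, Measurable fun t =>
      inner ℂ φ ((star (U t : H →L[ℂ] H) * B * (U t : H →L[ℂ] H)) φ) := by
    intro φ
    have h2 : Continuous fun y : H => inner ℂ y (B y) := continuous_id.inner B.continuous
    convert h2.measurable.comp (hU φ) using 2 with t
    rw [mul_apply_eq_comp, mul_apply_eq_comp,
      ContinuousLinearMap.star_eq_adjoint, ContinuousLinearMap.adjoint_inner_right]
    rfl
  refine (h1 ψ).sub (measurable_of_tendsto_metrizable' Filter.atTop
    (f := fun (s : Finset ρ.eigenIndex) t => ∑ i ∈ s, (ρ.eigenvalue i : ℂ)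
      * inner ℂ (ρ.eigenbasis i) ((star (U t : H →L[ℂ] H) * B * (U t : H →L[ℂ] H)) (ρ.eigenbasis i)))
    (fun s => Finset.measurable_fun_sum _ fun i _ => (h1 _).const_mul _)
    (tendsto_pi_nhds.2 fun t => ?_))
  simpa [HasSum, SummationFilter.unconditional_filter] using
    ρ.hasSum_expect (star (U t : H →L[ℂ] H) * B * (U t : H →L[ℂ] H))

/-- Concentration of the time-averaged deviation under `GAP(ρ)`. -/
theorem GAP_time_average_tail (ρ : DensityOperator H) (B : H →L[ℂ] H) (hB : 0 < ‖B‖)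
    (U : ℝ → unitary (H →L[ℂ] H)) (hU : ∀ φ : H, Measurable fun t => (U t : H →L[ℂ] H) φ)
    {ε T : ℝ} (hε : 0 ≤ ε) (hT : 0 < T) :
    GAP ρ {ψ : Metric.sphere (0 : H) 1 | ε < (1 / T) * ∫ t in (0 : ℝ)..T,
        ‖inner ℂ (ψ : H) ((star (U t : H →L[ℂ] H) * B * (U t : H →L[ℂ] H)) ψ)
          - ρ.expect (star (U t : H →L[ℂ] H) * B * (U t : H →L[ℂ] H))‖}
      ≤ ENNReal.ofReal
        (9 * Real.exp (-(1 / (2304 * Real.pi ^ 2) / (‖B‖ ^ 2 * ‖ρ.op‖) * ε ^ 2))) := by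
  have hfinite : IsFiniteMeasure (GAP ρ) := ⟨(GAP_univ_le ρ).trans_lt ENNReal.one_lt_top⟩
  set a := 1 / (2304 * Real.pi ^ 2) / (‖B‖ ^ 2 * ‖ρ.op‖) with ha
  have ha0 : 0 ≤ a := by positivity
  let C : ℝ → H →L[ℂ] H := fun t => star (U t : H →L[ℂ] H) * B * (U t : H →L[ℂ] H)
  have hC : ∀ t, ‖C t‖ = ‖B‖ := fun t => norm_star_mul_mul_unitary (U t) B
  let X : Metric.sphere (0 : H) 1 → ℝ → ℝ := fun ψ t =>
    ‖inner ℂ (ψ : H) (C t ψ) - ρ.expect (C t)‖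
  have hXt : ∀ ψ, Measurable (X ψ) := fun ψ => (measurable_inner_sub_expect ρ B U hU ψ).norm
  -- A Carathéodory function, continuous in ψ and measurable in t, is jointly measurable; Tonelli
  -- requires this below.
  have hXm : Measurable (Function.uncurry X) :=
    measurable_uncurry_of_continuous_of_measurable
      (fun t => continuous_norm_inner_sub_expect ρ (C t)) hXt
  have hXb : ∀ ψ t, |X ψ t| ≤ 2 * ‖B‖ := fun ψ t => by
    rw [abs_norm, ← hC t]
    exact ρ.norm_inner_sub_expect_le (C t) ψ
  have hjoint : Measurable (Function.uncurry fun ψ t =>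
      ENNReal.ofReal (Real.exp (a * X ψ t ^ 2))) := by
    have : Measurable fun q => ENNReal.ofReal (Real.exp (a * Function.uncurry X q ^ 2)) := by
      fun_prop
    exact this
  refine measure_le_of_lintegral_le (g := fun ψ => ENNReal.ofReal (1 / T)
      * ∫⁻ t in Set.Ioc 0 T, ENNReal.ofReal (Real.exp (a * X ψ t ^ 2)))
    (hjoint.lintegral_prod_right.const_mul _) ?_ fun ψ hψ => ?_
  · rw [lintegral_const_mul _ hjoint.lintegral_prod_right,
      lintegral_lintegral_swap hjoint.aemeasurable]
    calc _ ≤ ENNReal.ofReal (1 / T) * ∫⁻ _ in Set.Ioc 0 T, 9 := by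
          gcongr with t
          exact lintegral_exp_sq_GAP_le ρ (C t) hB (hC t).le
      _ = ENNReal.ofReal 9 := by
        rw [setLIntegral_const, Real.volume_Ioc, sub_zero, mul_comm 9, ← mul_assoc,
          ← ENNReal.ofReal_mul (by positivity), one_div, inv_mul_cancel₀ hT.ne']
        simp
  · refine le_trans (ENNReal.ofReal_le_ofReal (Real.exp_le_exp.2 ?_))
      (ofReal_exp_sq_average_le ha0 hT (hXt ψ) (hXb ψ))
    have hψ' : ε < (1 / T) * ∫ t in (0 : ℝ)..T, X ψ t := hψ
    gcongr

end

/-! ### The two concentration bounds -/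

theorem corollary2 {H : Type*} [NormedAddCommGroup H] [InnerProductSpace ℂ H] [CompleteSpace H]
    [TopologicalSpace.SeparableSpace H] [MeasurableSpace H] [BorelSpace H]
    (B : H →L[ℂ] H) (ρ : DensityOperator H)
    (U : ℝ → unitary (H →L[ℂ] H)) (hU : IsMeasurableFamily U) :
    (∀ ε t : ℝ, 0 ≤ ε → 0 ≤ t →
      GAP ρ {ψ : Metric.sphere (0 : H) 1 |
          ε < ‖inner ℂ ((U t : H →L[ℂ] H) ψ) (B ((U t : H →L[ℂ] H) ψ))
                - opTrace (((U t : H →L[ℂ] H) * ρ.op * star (U t : H →L[ℂ] H)) * B)‖} ≤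
        ENNReal.ofReal
          (12 * Real.exp (-((1 / (2304 * Real.pi ^ 2)) * ε ^ 2 / (‖B‖ ^ 2 * ‖ρ.op‖))))) ∧
    (∀ ε T : ℝ, 0 < ε → 0 < T →
      GAP ρ {ψ : Metric.sphere (0 : H) 1 |
          ε < (1 / T) * ∫ t in (0 : ℝ)..T,
              ‖inner ℂ ((U t : H →L[ℂ] H) ψ) (B ((U t : H →L[ℂ] H) ψ))
                - opTrace (((U t : H →L[ℂ] H) * ρ.op * star (U t : H →L[ℂ] H)) * B)‖} ≤
        ENNReal.ofReal
          (9 * Real.exp (-((1 / (2304 * Real.pi ^ 2)) * ε ^ 2 / (36 * ‖B‖ ^ 2 * ‖ρ.op‖))))) := by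
  have hr : 0 < ‖ρ.op‖ := ρ.norm_op_pos
  simp only [inner_apply_sub_opTrace]
  -- For B = 0 division by zero makes the exponents 0, so the right-hand sides are 12 and 9, above
  -- the total mass.
  rcases eq_or_ne B 0 with rfl | hB0
  · have h1 : ∀ (s : Set (Metric.sphere (0 : H) 1)) (K : ℝ), 1 ≤ K → GAP ρ s ≤ ENNReal.ofReal K :=
      fun s K hK => ((measure_mono (Set.subset_univ s)).trans (GAP_univ_le ρ)).trans
        (by rw [← ENNReal.ofReal_one]; exact ENNReal.ofReal_le_ofReal hK)
    exact ⟨fun ε t _ _ => h1 _ _ (by simp), fun ε T _ _ => h1 _ _ (by simp)⟩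
  have hB : 0 < ‖B‖ := norm_pos_iff.2 hB0
  refine ⟨fun ε t hε ht => ?_, fun ε T hε hT => ?_⟩
  · refine (measure_le_of_lintegral_le (K := 9)
      (c := 1 / (2304 * Real.pi ^ 2) / (‖B‖ ^ 2 * ‖ρ.op‖) * ε ^ 2) ?_
      ((lintegral_exp_sq_GAP_le ρ _ hB (norm_star_mul_mul_unitary (U t) B).le).trans
        (by simp)) fun ψ hψ => ?_).trans (ENNReal.ofReal_le_ofReal ?_)
    · have := (continuous_norm_inner_sub_expect ρ
        (star (U t : H →L[ℂ] H) * B * (U t : H →L[ℂ] H))).measurable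
      fun_prop
    · rw [Set.mem_ofPred_eq] at hψ
      gcongr
    · rw [div_mul_eq_mul_div]
      gcongr
      norm_num
  -- Measurability is assumed only on [0, ∞). Freezing the family at time 0 for negative t makes it
  -- measurable on ℝ without changing the integral over [0, T].
  · let V : ℝ → unitary (H →L[ℂ] H) := fun t => U (max t 0)
    have hV : ∀ φ : H, Measurable fun t => (V t : H →L[ℂ] H) φ := fun φ =>
      (hU φ).comp (f := fun t : ℝ => (⟨max t 0, le_max_right t 0⟩ : Set.Ici (0 : ℝ)))
        (Measurable.subtype_mk (by fun_prop))
    have hUV : ∀ ψ : H, ∫ t in (0 : ℝ)..T,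
        ‖inner ℂ ψ ((star (U t : H →L[ℂ] H) * B * (U t : H →L[ℂ] H)) ψ)
          - ρ.expect (star (U t : H →L[ℂ] H) * B * (U t : H →L[ℂ] H))‖
        = ∫ t in (0 : ℝ)..T,
        ‖inner ℂ ψ ((star (V t : H →L[ℂ] H) * B * (V t : H →L[ℂ] H)) ψ)
          - ρ.expect (star (V t : H →L[ℂ] H) * B * (V t : H →L[ℂ] H))‖ := by
      intro ψ
      refine intervalIntegral.integral_congr fun t ht => ?_
      rw [Set.uIcc_of_le hT.le] at ht
      simp only [V, max_eq_left ht.1]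
    simp only [hUV]
    refine (GAP_time_average_tail ρ B hB V hV hε.le hT).trans (ENNReal.ofReal_le_ofReal ?_)
    rw [div_mul_eq_mul_div]
    gcongr
    nlinarith [sq_nonneg ‖B‖]
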